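/- Let $n\ge 1$ and $0\le i\le n$ be integers. Let $\mathcal E^i(\mathbb R^n)\simeq C^\infty(\mathbb R^n)\otimes\bigwedge^i(\mathbb C^n)$ be the space of smooth complex-valued differential $i$-forms on $\mathbb R^n$, let $\mathcal E^i_c(\mathbb R^n)$ be the subspace of compactly supported ones, let $\sigma^{(i)}$ be the $i$-th exterior power of the natural representation of $O(n)$ on $\mathbb C^n$, and set $\psi_n(x):=I_n-\frac{2x\,{}^t x}{|x|^2}\in O(n)$ for $x\in\mathbb R^n\setminus\{0\}$. For $\lambda\in\mathbb C$ with $\operatorname{Re}\lambda>\frac n2$, define the locally integrable $\operatorname{End}_{\mathbb C}(\bigwedge^i(\mathbb C^n))$-valued function $$\widetilde{\mathcal T}^{(i)}_{\lambda}(x):=\frac{1}{\Gamma(\lambda-\frac n2)}\,|x|^{2(\lambda-n)}\,\sigma^{(i)}(\psi_n(x)).$$ The linear operators $\mathcal E^i_c(\mathbb R^n)\to\mathcal E^i(\mathbb R^n)$, $f\mapsto\widetilde{\mathcal T}^{(i)}_\lambda * f$, defined for $\operatorname{Re}\lambda>\frac n2$, have a unique analytic continuation to a family of linear operators $\widetilde{\mathbb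 T}^{(i)}_{\lambda,n-\lambda}:\mathcal E^i_c(\mathbb R^n)\to\mathcal E^i(\mathbb R^n)$ for all $\lambda\in\mathbb C$ (meaning that $\lambda\mapsto(\widetilde{\mathbb T}^{(i)}_{\lambda,n-\lambda}f)(x)$ is an entire function for every $f$ and every $x$). This is the matrix-valued Knapp--Stein operator (in the $N$-picture). For every $\lambda\in\mathbb C$, $$\widetilde{\mathbb T}^{(i)}_{\lambda,n-\lambda}=0\quad\text{if and only if}\quad n\text{ is even and } i=\lambda=\tfrac n2 .$$ -/

import Mathlib

open scoped ContDiff Matrix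

noncomputable section

namespace KnappStein

/-- Euclidean space `ℝⁿ`. -/
abbrev Rn (n : ℕ) : Type := EuclideanSpace ℝ (Fin n)

/-- Complex-valued alternating `i`-forms on `ℝⁿ`.  It is identified with `⋀ⁱ(ℂⁿ)` by
`e_{k₁} ∧ ⋯ ∧ e_{kᵢ} ↦ dx_{k₁} ∧ ⋯ ∧ dx_{kᵢ}`. -/
abbrev Form (n i : ℕ) : Type := Rn n [⋀^Fin i]→L[ℝ] ℂ

/-- The space `ℰⁱ(ℝⁿ)` of smooth complex-valued differential `i`-forms on `ℝⁿ`. -/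
def SmoothForms (n i : ℕ) : Submodule ℂ (Rn n → Form n i) where
  carrier := {f | ContDiff ℝ ∞ f}
  add_mem' {f g} hf hg := by
    rw [Set.mem_ofPred_eq] at *
    exact hf.add hg
  zero_mem' := by
    rw [Set.mem_ofPred_eq]
    exact contDiff_const (c := (0 : Form n i))
  smul_mem' c f hf := by
    rw [Set.mem_ofPred_eq] at *
    exact hf.const_smul c

/-- The space `ℰ_cⁱ(ℝⁿ)` of smooth compactly supported complex-valued differential `i`-forms. -/
def CompactForms (n i : ℕ) : Submodule ℂ (Rn n → Form n i) where
  carrier := {f | ContDiff ℝ ∞ f ∧ HasCompactSupport f}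
  add_mem' hf hg := ⟨hf.1.add hg.1, hf.2.add hg.2⟩
  zero_mem' := ⟨contDiff_const, HasCompactSupport.zero⟩
  smul_mem' c _ hf := ⟨hf.1.const_smul c, hf.2.smul_left (f := fun _ => c)⟩

/-- `ψₙ(x) = Iₙ - 2 x ᵗx / |x|²`, the matrix of the reflection with normal vector `x ≠ 0`. -/
def psi {n : ℕ} (x : Rn n) : Matrix (Fin n) (Fin n) ℝ :=
  1 - (2 / ‖x‖ ^ 2) • Matrix.vecMulVec x x

/-- The `i`-th exterior power `σ⁽ⁱ⁾(g)` of a matrix `g`, acting on `i`-forms.  On `1`-forms it is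
`dx_k ↦ ∑ l, g l k • dx_l` (as `g e_k = ∑ l, g l k • e_l`), which is composition with `gᵀ`. -/
def sigma {n : ℕ} (i : ℕ) (g : Matrix (Fin n) (Fin n) ℝ) : Form n i →L[ℂ] Form n i where
  toFun α := α.compContinuousLinearMap (Matrix.toEuclideanCLM (𝕜 := ℝ) gᵀ)
  map_add' _ _ := rfl
  map_smul' _ _ := rfl
  cont := (ContinuousAlternatingMap.compContinuousLinearMapCLM
    (Matrix.toEuclideanCLM (𝕜 := ℝ) gᵀ)).continuous

/-- The `End_ℂ(⋀ⁱ(ℂⁿ))`-valued function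
`x ↦ Γ(λ - n/2)⁻¹ |x|^{2(λ - n)} σ⁽ⁱ⁾(ψₙ(x))`. -/
def kernel (n i : ℕ) (lam : ℂ) (x : Rn n) : Form n i →L[ℂ] Form n i :=
  ((Complex.Gamma (lam - n / 2))⁻¹ * (‖x‖ : ℂ) ^ (2 * (lam - n))) • sigma i (psi x)

/-- The convolution `(kernel ∗ f)(x) = ∫ kernel(y) (f (x - y)) dy`. -/
def conv (n i : ℕ) (lam : ℂ) (f : Rn n → Form n i) (x : Rn n) : Form n i :=
  ∫ y : Rn n, kernel n i lam y (f (x - y))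

/-- `T` is the analytic continuation to all `λ ∈ ℂ` of the convolution operators
`ℰ_cⁱ(ℝⁿ) → ℰⁱ(ℝⁿ)`, `f ↦ kernel ∗ f`: the operators `T λ` depend holomorphically on `λ ∈ ℂ`,
and they are the convolution operators for `Re λ > n/2`, which is where the kernel is locally
integrable. -/
structure IsKnappSteinFamily (n i : ℕ)
    (T : ℂ → CompactForms n i →ₗ[ℂ] SmoothForms n i) : Prop where
  holomorphic : ∀ (f : CompactForms n i) (x : Rn n),
    Differentiable ℂ fun lam : ℂ => (T lam f : Rn n → Form n i) x
  eq_conv : ∀ lam : ℂ, (n : ℝ) / 2 < lam.re → ∀ f : CompactForms n i,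
    (T lam f : Rn n → Form n i) = conv n i lam (f : Rn n → Form n i)

end KnappStein

end

/-!
# Vanishing of the matrix-valued Knapp-Stein operators

Put `s = 2 lam - n`.  The kernel is `Γ(s / 2)⁻¹ ‖y‖ ^ (s - n) P(y)` with the angular symbol
`P(y) = σ⁽ⁱ⁾(ψₙ(y))`, which is even and constant on rays.

*Continuation.*  Write `C_s^P f` for the convolution of `f` with `‖y‖ ^ (s - n) P(y)`.  Integration
by parts along rays gives `s C_s^P f = C_{s+1}^{P'} f'`, where `P'` pairs the derivative of `f` with
the radial direction before applying `P` (`IsAngular.smul_rieszConv`).  Two steps lead back to an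
even symbol and give
`Γ(s / 2)⁻¹ C_s^P f = (2 (s + 1))⁻¹ Γ((s + 2) / 2)⁻¹ C_{s+2}^{P''} f''`,
so that the half plane of definition grows by `2`.  The factor `(s + 1)⁻¹` causes no pole since
`C_1^{P''} f'' = 0` for even `P` (`IsAngular.rieszConv_one_of_odd`).  Every value of the continued
family is a convolution of a derivative of `f` with a locally integrable kernel, with a logarithm at
the exceptional exponents, hence smooth (`exists_continuation_halfPlane`).

*The value at `s = 0`.*  The mean of `P` over the sphere is `1 - 2i/n`
(`setIntegral_centeredSymbol`).  For a symbol of mean zero the convolutions stay bounded as `s → 0`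
while `Γ(s / 2)⁻¹ → 0`; thus the operator at `s = 0` is `1 - 2i/n` times the one with symbol `1`,
which is not zero (`IsKnappSteinFamily.half_eq_zero_iff`).

*The values at `s ≠ 0`.*  Let `p(y)` be the diagonal matrix coefficient of `‖y‖² P(y)` at
`α = dx₁ ∧ ⋯ ∧ dxᵢ`; it is the quadratic form `‖y‖² - 2 (y₁² + ⋯ + yᵢ²)`.  Applied to
`f = χ ‖y‖ ^ (2 (k - 1)) p α` with `k ≥ 1`, the operator has at the origin the matrix coefficient
`(s / 2) (s / 2 + 1) ⋯ (s / 2 + k - 1)` times the normalized integral of `χ` against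
`‖y‖ ^ (s + 2 k - n) q`, where `q = (p / ‖y‖²)² ≥ 0` (`IsKnappSteinFamily.apply_testForm`).  If
`s = -2 k`, this integral sits at exponent `0`, where its value is positive because `q ≥ 0`
(`scalar_continuation_zero_ne_zero`).  For all other `s ≠ 0` a large `k` makes the kernel locally
integrable and no factor vanishes (`IsKnappSteinFamily.ne_zero`).
-/

noncomputable section

set_option linter.unusedSectionVars false

namespace KnappStein

open MeasureTheory Filter Topology Set Module

section General

variable {V : Type} [NormedAddCommGroup V] [NormedSpace ℝ V] [FiniteDimensional ℝ V]
  [MeasurableSpace V] [BorelSpace V] {μ : Measure V} [μ.IsAddHaarMeasure]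
  {E : Type} [NormedAddCommGroup E] [NormedSpace ℝ E]
  {F : Type} [NormedAddCommGroup F] [NormedSpace ℝ F] [NormedSpace ℂ F] [IsScalarTower ℝ ℂ F]

/-! ### Homogeneous kernels -/

/-- An angular symbol: a bounded measurable operator-valued function on `V` that is constant on
open rays from the origin. -/
structure IsAngular (μ : Measure V) (P : V → E →L[ℝ] F) : Prop where
  aestronglyMeasurable : AEStronglyMeasurable P μ
  exists_bound : ∃ C, ∀ y, ‖P y‖ ≤ C
  map_smul : ∀ t : ℝ, 0 < t → ∀ y, P (t • y) = P y

/-- The homogeneous kernel `y ↦ ‖y‖ ^ (s - dim V) P(y)`. -/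
def rieszKernel (P : V → E →L[ℝ] F) (s : ℂ) (y : V) : E →L[ℝ] F :=
  ((‖y‖ : ℂ) ^ (s - (finrank ℝ V : ℂ))) • P y

/-- The convolution of `f` with the homogeneous kernel `‖y‖ ^ (s - dim V) P(y)`. -/
def rieszConv (μ : Measure V) (P : V → E →L[ℝ] F) (s : ℂ) (f : V → E) (x : V) : F :=
  ∫ y, rieszKernel P s y (f (x - y)) ∂μ

lemma norm_ofReal_norm_cpow {y : V} (hy : y ≠ 0) (z : ℂ) : ‖(‖y‖ : ℂ) ^ z‖ = ‖y‖ ^ z.re :=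
  Complex.norm_cpow_eq_rpow_re_of_pos (norm_pos_iff.2 hy) z

lemma measurable_norm_cpow (z : ℂ) : Measurable fun y : V => (‖y‖ : ℂ) ^ z :=
  (Complex.measurable_ofReal.comp measurable_norm).pow_const z

lemma norm_rieszKernel {y : V} (hy : y ≠ 0) (P : V → E →L[ℝ] F) (s : ℂ) :
    ‖rieszKernel P s y‖ = ‖y‖ ^ (s.re - finrank ℝ V) * ‖P y‖ := by
  rw [rieszKernel, norm_smul, norm_ofReal_norm_cpow hy]
  simp

lemma IsAngular.aestronglyMeasurable_rieszKernel {P : V → E →L[ℝ] F} (hP : IsAngular μ P) (s : ℂ) :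
    AEStronglyMeasurable (rieszKernel P s) μ :=
  (measurable_norm_cpow _).aestronglyMeasurable.smul hP.aestronglyMeasurable

lemma IsAngular.exists_nonneg_bound {P : V → E →L[ℝ] F} (hP : IsAngular μ P) :
    ∃ C, 0 ≤ C ∧ ∀ y, ‖P y‖ ≤ C := by
  obtain ⟨C, hC⟩ := hP.exists_bound
  exact ⟨C, (norm_nonneg _).trans (hC 0), hC⟩

lemma ae_ne_zero [Nontrivial V] : ∀ᵐ y ∂μ, y ≠ (0 : V) := by
  simp [ae_iff, measure_singleton]

lemma aestronglyMeasurable_of_continuousOn [Nontrivial V] {G : Type} [NormedAddCommGroup G]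
    {g : V → G} (hg : ContinuousOn g {0}ᶜ) : AEStronglyMeasurable g μ := by
  have h := hg.aestronglyMeasurable (μ := μ) (measurableSet_singleton 0).compl
  rwa [Measure.restrict_eq_self_of_ae_mem] at h
  exact ae_ne_zero

lemma locallyIntegrable_norm_rpow [Nontrivial V] {a : ℝ} (ha : 0 < a) :
    LocallyIntegrable (fun y : V => ‖y‖ ^ (a - finrank ℝ V)) μ := by
  refine locallyIntegrable_of_norm_le_rpow (C := 1) (α := finrank ℝ V - a)
    (Nat.one_le_iff_ne_zero.2 (finrank_pos (R := ℝ) (M := V)).ne') (by linarith) ?_ ?_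
  · refine Eventually.of_forall fun y => ?_
    rw [Real.norm_of_nonneg (by positivity), one_mul, neg_sub]
  · exact (measurable_norm.pow_const _).aestronglyMeasurable

lemma IsAngular.locallyIntegrable_rieszKernel [Nontrivial V] {P : V → E →L[ℝ] F}
    (hP : IsAngular μ P) {s : ℂ} (hs : 0 < s.re) : LocallyIntegrable (rieszKernel P s) μ := by
  obtain ⟨C, hC0, hC⟩ := hP.exists_nonneg_bound
  refine ((locallyIntegrable_norm_rpow hs).smul C).mono
    (hP.aestronglyMeasurable_rieszKernel s) ?_
  filter_upwards [ae_ne_zero] with y hy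
  rw [norm_rieszKernel hy, Pi.smul_apply, smul_eq_mul, mul_comm]
  refine le_trans ?_ (le_abs_self _)
  gcongr
  exact hC y

/-- The derivative of `rieszKernel P s` with respect to the complex exponent `s`. -/
def logKernel (P : V → E →L[ℝ] F) (s : ℂ) (y : V) : E →L[ℝ] F :=
  (Complex.log ‖y‖) • rieszKernel P s y

lemma abs_log_mul_rpow_le {r a c : ℝ} (hr : 0 < r) (ha : 0 < a) (h1 : 2 * a ≤ c) (h2 : c ≤ 6 * a) :
    |Real.log r| * r ^ c ≤ a⁻¹ * (r ^ a + r ^ (3 * a) + r ^ (5 * a) + r ^ (7 * a)) := by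
  have hlog : |Real.log r| ≤ (r ^ a + r ^ (-a)) / a := by
    have h1 := Real.log_le_rpow_div hr.le ha
    have h2 := Real.log_le_rpow_div (inv_pos.2 hr).le ha
    rw [Real.log_inv, Real.inv_rpow hr.le, ← Real.rpow_neg hr.le] at h2
    have h3 : 0 ≤ r ^ a / a := by positivity
    have h4 : 0 ≤ r ^ (-a) / a := by positivity
    rw [add_div, abs_le]
    constructor <;> linarith
  have hpow : r ^ c ≤ r ^ (2 * a) + r ^ (6 * a) := by
    rcases le_total r 1 with h | h
    · have := Real.rpow_le_rpow_of_exponent_ge hr h h1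
      have : 0 ≤ r ^ (6 * a) := by positivity
      linarith
    · have := Real.rpow_le_rpow_of_exponent_le h h2
      have : 0 ≤ r ^ (2 * a) := by positivity
      linarith
  calc |Real.log r| * r ^ c ≤ (r ^ a + r ^ (-a)) / a * (r ^ (2 * a) + r ^ (6 * a)) := by gcongr
    _ = a⁻¹ * (r ^ a * r ^ (2 * a) + r ^ a * r ^ (6 * a) + r ^ (-a) * r ^ (2 * a)
          + r ^ (-a) * r ^ (6 * a)) := by ring
    _ = _ := by
      simp only [← Real.rpow_add hr]
      ring_nf

/-- A locally integrable majorant of the logarithmic kernels with exponents near `s`. -/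
lemma IsAngular.exists_bound_logKernel [Nontrivial V] {P : V → E →L[ℝ] F} (hP : IsAngular μ P)
    {s₀ : ℂ} (hs : 0 < s₀.re) : ∃ b : V → ℝ, LocallyIntegrable b μ ∧
      ∃ δ > 0, ∀ s ∈ Metric.ball s₀ δ, ∀ y ≠ 0, ‖logKernel P s y‖ ≤ b y := by
  obtain ⟨C, hC0, hC⟩ := hP.exists_nonneg_bound
  set a := s₀.re / 4 with ha_def
  have ha : 0 < a := by positivity
  have hli (k : ℝ) (hk : 0 < k) := locallyIntegrable_norm_rpow (μ := μ) (a := k * a) (by positivity)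
  refine ⟨_, ((((hli 1 one_pos).add (hli 3 (by norm_num))).add (hli 5 (by norm_num))).add
    (hli 7 (by norm_num))).smul (C * a⁻¹), 2 * a, by positivity, fun s hs y hy => ?_⟩
  have hre : |s.re - s₀.re| < 2 * a := by
    have := Complex.abs_re_le_norm (s - s₀)
    rw [Complex.sub_re] at this
    exact this.trans_lt (by simpa [dist_eq_norm] using hs)
  rw [abs_lt] at hre
  have hy' := norm_pos_iff.2 hy
  have key := abs_log_mul_rpow_le hy' ha (c := s.re) (by linarith) (by linarith)
  have hlog : ‖Complex.log ‖y‖‖ = |Real.log ‖y‖| := by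
    rw [← Complex.ofReal_log hy'.le]; simp
  rw [logKernel, norm_smul, norm_rieszKernel hy, hlog]
  simp only [Pi.smul_apply, Pi.add_apply, smul_eq_mul, one_mul, Real.rpow_sub hy']
  calc |Real.log ‖y‖| * (‖y‖ ^ s.re / ‖y‖ ^ (finrank ℝ V : ℝ) * ‖P y‖)
      = (|Real.log ‖y‖| * ‖y‖ ^ s.re) / ‖y‖ ^ (finrank ℝ V : ℝ) * ‖P y‖ := by ring
    _ ≤ (a⁻¹ * (‖y‖ ^ a + ‖y‖ ^ (3 * a) + ‖y‖ ^ (5 * a) + ‖y‖ ^ (7 * a)))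
          / ‖y‖ ^ (finrank ℝ V : ℝ) * C := by
        gcongr
        exact hC y
    _ = _ := by ring

lemma IsAngular.aestronglyMeasurable_logKernel {P : V → E →L[ℝ] F} (hP : IsAngular μ P) (s : ℂ) :
    AEStronglyMeasurable (logKernel P s) μ :=
  (Complex.measurable_log.comp (Complex.measurable_ofReal.comp
    measurable_norm)).aestronglyMeasurable.smul (hP.aestronglyMeasurable_rieszKernel s)

lemma IsAngular.locallyIntegrable_logKernel [Nontrivial V] {P : V → E →L[ℝ] F}
    (hP : IsAngular μ P) {s : ℂ} (hs : 0 < s.re) : LocallyIntegrable (logKernel P s) μ := by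
  obtain ⟨b, hb, δ, hδ, hle⟩ := hP.exists_bound_logKernel hs
  refine hb.mono (hP.aestronglyMeasurable_logKernel s) ?_
  filter_upwards [ae_ne_zero] with y hy
  exact (hle s (Metric.mem_ball_self hδ) y hy).trans (le_abs_self _)

lemma aestronglyMeasurable_clm_apply {K : V → E →L[ℝ] F} (hK : AEStronglyMeasurable K μ)
    {g : V → E} (hg : Continuous g) : AEStronglyMeasurable (fun y => K y (g y)) μ :=
  (ContinuousLinearMap.id ℝ (E →L[ℝ] F)).aestronglyMeasurable_comp₂ hK hg.aestronglyMeasurable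

lemma hasCompactSupport_comp_sub {f : V → E} (hf : HasCompactSupport f) (x : V) :
    HasCompactSupport fun y => f (x - y) :=
  hf.comp_homeomorph (Homeomorph.subLeft x)

lemma integrable_clm_apply {K : V → E →L[ℝ] F} (hK : LocallyIntegrable K μ)
    {g : V → E} (hg : Continuous g) (hg' : HasCompactSupport g) :
    Integrable (fun y => K y (g y)) μ := by
  have h : Integrable (fun y => ‖g y‖ • ‖K y‖) μ :=
    LocallyIntegrable.integrable_smul_left_of_hasCompactSupport (fun x => (hK x).norm) hg.norm
      hg'.norm
  refine h.mono' (aestronglyMeasurable_clm_apply hK.aestronglyMeasurable hg)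
    (Eventually.of_forall fun y => ?_)
  rw [smul_eq_mul, mul_comm]
  exact (K y).le_opNorm _

lemma contDiff_integral_clm_apply [CompleteSpace F] {K : V → E →L[ℝ] F}
    (hK : LocallyIntegrable K μ) {f : V → E} (hf : ContDiff ℝ ∞ f) (hf' : HasCompactSupport f) :
    ContDiff ℝ ∞ fun x => ∫ y, K y (f (x - y)) ∂μ :=
  hf'.contDiff_convolution_right (ContinuousLinearMap.id ℝ (E →L[ℝ] F)) hK hf

/-- The convolutions `rieszConv μ P s f x` are holomorphic in `s` on the half plane of local
integrability, and the derivative is again a convolution with a locally integrable kernel. -/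
lemma IsAngular.hasDerivAt_rieszConv [Nontrivial V] {P : V → E →L[ℝ] F}
    (hP : IsAngular μ P) {s₀ : ℂ} (hs : 0 < s₀.re) {f : V → E} (hf : Continuous f)
    (hf' : HasCompactSupport f) (x : V) :
    HasDerivAt (fun s => rieszConv μ P s f x) (∫ y, logKernel P s₀ y (f (x - y)) ∂μ) s₀ := by
  obtain ⟨b, hb, δ, hδ, hle⟩ := hP.exists_bound_logKernel hs
  have hc : Continuous fun y => f (x - y) := by fun_prop
  have hcs := hasCompactSupport_comp_sub hf' x
  refine (hasDerivAt_integral_of_dominated_loc_of_deriv_le (Metric.ball_mem_nhds s₀ hδ)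
    (F := fun s y => rieszKernel P s y (f (x - y)))
    (F' := fun s y => logKernel P s y (f (x - y))) (bound := fun y => ‖f (x - y)‖ • b y)
    (Eventually.of_forall fun s =>
      aestronglyMeasurable_clm_apply (hP.aestronglyMeasurable_rieszKernel s) hc)
    (integrable_clm_apply (hP.locallyIntegrable_rieszKernel hs) hc hcs)
    (aestronglyMeasurable_clm_apply (hP.aestronglyMeasurable_logKernel s₀) hc) ?_
    (hb.integrable_smul_left_of_hasCompactSupport hc.norm hcs.norm) ?_).2
  · filter_upwards [ae_ne_zero] with y hy s hs
    rw [smul_eq_mul, mul_comm]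
    exact ((logKernel P s y).le_opNorm _).trans (by gcongr; exact hle s hs y hy)
  · filter_upwards [ae_ne_zero] with y hy s _
    have h0 : (‖y‖ : ℂ) ≠ 0 := by simpa using hy
    have h : HasDerivAt (fun s : ℂ => (‖y‖ : ℂ) ^ (s - (finrank ℝ V : ℂ)))
        ((‖y‖ : ℂ) ^ (s - (finrank ℝ V : ℂ)) * Complex.log ‖y‖ * 1) s :=
      ((hasDerivAt_id s).sub_const _).const_cpow (Or.inl h0)
    have := h.smul_const (P y (f (x - y)))
    refine HasDerivAt.congr_deriv (f := fun s => rieszKernel P s y (f (x - y))) this ?_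
    change _ = Complex.log ‖y‖ • ((‖y‖ : ℂ) ^ (s - (finrank ℝ V : ℂ)) • P y (f (x - y)))
    module

/-! ### Integration by parts along rays -/

/-- Euler's identity in weak form: a kernel homogeneous of degree `s - dim V` is an eigenvector of
the transpose of the radial vector field.  It follows by differentiating
`∫ K(y) G(t y) dy = t ^ (-s) ∫ K(y) G(y) dy` at `t = 1`. -/
lemma smul_integral_of_homogeneous {K : V → E →L[ℝ] F} {s : ℂ} (hKm : AEStronglyMeasurable K μ)
    (hK : LocallyIntegrable (fun y => ‖y‖ • K y) μ)
    (hom : ∀ t : ℝ, 0 < t → ∀ y, K (t • y) = ((t : ℂ) ^ (s - (finrank ℝ V : ℂ))) • K y)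
    {G : V → E} (hG : ContDiff ℝ 1 G) (hGc : HasCompactSupport G)
    (hint : Integrable (fun y => K y (G y)) μ) :
    s • ∫ y, K y (G y) ∂μ = -∫ y, K y (fderiv ℝ G y y) ∂μ := by
  have hG0 := hG.continuous
  have hG1 : Continuous (fderiv ℝ G) := hG.continuous_fderiv one_ne_zero
  obtain ⟨M, hM⟩ := hG1.bounded_above_of_compact_support (hGc.fderiv ℝ)
  obtain ⟨R, hR⟩ := (hGc.fderiv ℝ).isCompact.isBounded.subset_closedBall 0
  have hM0 : 0 ≤ M := (norm_nonneg _).trans (hM 0)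
  have hder : HasDerivAt (fun t : ℝ => ∫ y, K y (G (t • y)) ∂μ)
      (∫ y, K y (fderiv ℝ G ((1 : ℝ) • y) y) ∂μ) 1 := by
    refine (hasDerivAt_integral_of_dominated_loc_of_deriv_le
      (Metric.ball_mem_nhds (1 : ℝ) one_half_pos)
      (F := fun t y => K y (G (t • y))) (F' := fun t y => K y (fderiv ℝ G (t • y) y))
      (bound := (Metric.closedBall (0 : V) (2 * R)).indicator fun y => M * ‖‖y‖ • K y‖)
      (Eventually.of_forall fun t => aestronglyMeasurable_clm_apply hKm (by fun_prop))
      (by simpa using hint) (aestronglyMeasurable_clm_apply hKm (by fun_prop)) ?_ ?_ ?_).2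
    · refine Eventually.of_forall fun y t ht => ?_
      by_cases hy : fderiv ℝ G (t • y) = 0
      · simpa [hy] using indicator_nonneg (fun y _ => by positivity) y
      · have h1 : ‖t • y‖ ≤ R := by
          simpa using hR (subset_closure (Function.mem_support.2 hy))
        have h2 : y ∈ Metric.closedBall (0 : V) (2 * R) := by
          rw [mem_closedBall_zero_iff]
          rw [Metric.mem_ball, Real.dist_eq, abs_lt] at ht
          rw [norm_smul, Real.norm_eq_abs, abs_of_pos (by linarith)] at h1
          nlinarith [norm_nonneg y]
        rw [indicator_of_mem h2, norm_smul, norm_norm]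
        calc ‖K y (fderiv ℝ G (t • y) y)‖ ≤ ‖K y‖ * (M * ‖y‖) :=
              (K y).le_opNorm_of_le ((fderiv ℝ G (t • y)).le_of_opNorm_le (hM _) y)
          _ = M * (‖y‖ * ‖K y‖) := by ring
    · refine IntegrableOn.integrable_indicator ?_ measurableSet_closedBall
      exact ((hK.integrableOn_isCompact (isCompact_closedBall 0 (2 * R))).norm.const_mul M)
    · refine Eventually.of_forall fun y t _ => ?_
      have h1 : HasDerivAt (fun t : ℝ => t • y) y t := by
        simpa using (hasDerivAt_id t).smul_const y
      have h2 := ((hG.differentiable one_ne_zero (t • y)).hasFDerivAt).comp_hasDerivAt t h1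
      exact (K y).hasFDerivAt.comp_hasDerivAt t h2
  have hscale : ∀ t : ℝ, 0 < t →
      ∫ y, K y (G (t • y)) ∂μ = ((t : ℂ) ^ (-s)) • ∫ y, K y (G y) ∂μ := by
    intro t ht
    have ht0 : (t : ℂ) ≠ 0 := by exact_mod_cast ht.ne'
    have h1 : ∀ y, K y (G (t • y)) =
        ((t : ℂ) ^ ((finrank ℝ V : ℂ) - s)) • K (t • y) (G (t • y)) := by
      intro y
      rw [hom t ht y]
      change _ = ((t : ℂ) ^ ((finrank ℝ V : ℂ) - s)) •
        (((t : ℂ) ^ (s - (finrank ℝ V : ℂ))) • K y (G (t • y)))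
      rw [smul_smul, ← Complex.cpow_add _ _ ht0]
      simp
    simp_rw [h1]
    rw [integral_smul, Measure.integral_comp_smul_of_nonneg μ (fun y => K y (G y)) t (hR := ht.le),
      ← algebraMap_smul ℂ ((t ^ finrank ℝ V)⁻¹ : ℝ), smul_smul]
    congr 1
    rw [sub_eq_add_neg, Complex.cpow_add _ _ ht0, Complex.cpow_natCast]
    have : (t : ℂ) ^ finrank ℝ V ≠ 0 := pow_ne_zero _ ht0
    simp only [Complex.coe_algebraMap, Complex.ofReal_inv, Complex.ofReal_pow]
    field_simp
  have hder' : HasDerivAt (fun t : ℝ => ∫ y, K y (G (t • y)) ∂μ) (-s • ∫ y, K y (G y) ∂μ) 1 := by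
    have h1 : HasDerivAt (fun z : ℂ => z ^ (-s)) (-s * (1 : ℝ) ^ (-s - 1) * 1) ((1 : ℝ) : ℂ) :=
      (hasDerivAt_id _).cpow_const (Complex.ofReal_mem_slitPlane.2 one_pos)
    have h2 := h1.comp_ofReal.smul_const (∫ y, K y (G y) ∂μ)
    simp only [Complex.ofReal_one, Complex.one_cpow, mul_one] at h2
    refine h2.congr_of_eventuallyEq ?_
    filter_upwards [lt_mem_nhds (one_pos : (0 : ℝ) < 1)] with t ht
    exact hscale t ht
  have := hder.unique hder'
  simp only [one_smul] at this
  rw [this, neg_smul, neg_neg]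

lemma rieszKernel_smul (P : V → E →L[ℝ] F) (hP : IsAngular μ P) (s : ℂ) {t : ℝ} (ht : 0 < t)
    (y : V) : rieszKernel P s (t • y) =
      ((t : ℂ) ^ (s - (finrank ℝ V : ℂ))) • rieszKernel P s y := by
  rw [rieszKernel, rieszKernel, hP.map_smul t ht, smul_smul, norm_smul, Complex.ofReal_mul,
    Complex.mul_cpow_ofReal_nonneg (norm_nonneg _) (norm_nonneg _), Real.norm_of_nonneg ht.le]

/-- The symbol `A ↦ P(y) (A (y / ‖y‖))`, pairing an operator-valued function with the radial
direction before applying `P`. -/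
def angDeriv (P : V → E →L[ℝ] F) (y : V) : (V →L[ℝ] E) →L[ℝ] F :=
  (P y).comp (ContinuousLinearMap.apply ℝ E (‖y‖⁻¹ • y))

lemma norm_inv_norm_smul_le (y : V) : ‖‖y‖⁻¹ • y‖ ≤ 1 := by
  rw [norm_smul, norm_inv, norm_norm]
  exact inv_mul_le_one

lemma IsAngular.angDeriv {P : V → E →L[ℝ] F} (hP : IsAngular μ P) :
    IsAngular μ (angDeriv P) where
  aestronglyMeasurable := by
    have h : StronglyMeasurable fun y : V => ‖y‖⁻¹ • y :=
      (measurable_norm.inv.smul measurable_id).stronglyMeasurable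
    have h' : AEStronglyMeasurable
        (fun y : V => (ContinuousLinearMap.apply ℝ E (‖y‖⁻¹ • y) : (V →L[ℝ] E) →L[ℝ] E)) μ :=
      (ContinuousLinearMap.apply ℝ E).continuous.comp_aestronglyMeasurable h.aestronglyMeasurable
    exact (ContinuousLinearMap.compL ℝ (V →L[ℝ] E) E F).continuous₂.comp_aestronglyMeasurable
      (hP.aestronglyMeasurable.prodMk h')
  exists_bound := by
    obtain ⟨C, hC0, hC⟩ := hP.exists_nonneg_bound
    refine ⟨C, fun y => ContinuousLinearMap.opNorm_le_bound _ hC0 fun A => ?_⟩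
    have h : ‖A (‖y‖⁻¹ • y)‖ ≤ ‖A‖ := by
      simpa using A.le_opNorm_of_le (norm_inv_norm_smul_le y)
    exact ((P y).le_of_opNorm_le (hC y) _).trans (mul_le_mul_of_nonneg_left h hC0)
  map_smul t ht y := by
    have h : ‖t • y‖⁻¹ • t • y = ‖y‖⁻¹ • y := by
      rw [norm_smul, Real.norm_of_nonneg ht.le, smul_smul]
      congr 1
      field_simp
    rw [KnappStein.angDeriv, KnappStein.angDeriv, hP.map_smul t ht, h]

lemma angDeriv_neg_of_even {P : V → E →L[ℝ] F} (hP : ∀ y, P (-y) = P y) (y : V) :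
    angDeriv P (-y) = -angDeriv P y := by
  ext A
  simp [angDeriv, hP y]

lemma angDeriv_neg_of_odd {P : V → E →L[ℝ] F} (hP : ∀ y, P (-y) = -P y) (y : V) :
    angDeriv P (-y) = angDeriv P y := by
  ext A
  simp [angDeriv, hP y]

lemma rieszKernel_angDeriv_apply (P : V → E →L[ℝ] F) (s : ℂ) (y : V) (A : V →L[ℝ] E) :
    rieszKernel (angDeriv P) (s + 1) y A = rieszKernel P s y (A y) := by
  rcases eq_or_ne y 0 with rfl | hy
  · simp [rieszKernel, angDeriv]
  have h0 : (‖y‖ : ℂ) ≠ 0 := by simpa using hy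
  change (‖y‖ : ℂ) ^ (s + 1 - (finrank ℝ V : ℂ)) • P y (A (‖y‖⁻¹ • y)) =
    (‖y‖ : ℂ) ^ (s - (finrank ℝ V : ℂ)) • P y (A y)
  rw [map_smul, map_smul, ← algebraMap_smul ℂ (‖y‖⁻¹ : ℝ), smul_smul, add_sub_right_comm,
    Complex.cpow_add _ _ h0]
  congr 1
  simp [h0]

lemma IsAngular.locallyIntegrable_norm_smul [Nontrivial V] {P : V → E →L[ℝ] F}
    (hP : IsAngular μ P) {s : ℂ} (hs : -1 < s.re) :
    LocallyIntegrable (fun y => ‖y‖ • rieszKernel P s y) μ := by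
  refine (hP.locallyIntegrable_rieszKernel (s := s + 1) (by simpa using by linarith)).mono
    (measurable_norm.aestronglyMeasurable.smul (hP.aestronglyMeasurable_rieszKernel s)) ?_
  filter_upwards [ae_ne_zero] with y hy
  rw [norm_smul, norm_rieszKernel hy, norm_rieszKernel hy, norm_norm, Complex.add_re,
    Complex.one_re, add_sub_right_comm, Real.rpow_add_one (norm_ne_zero_iff.2 hy)]
  exact le_of_eq (by ring)

lemma fderiv_comp_const_sub' {f : V → E} (hf : Differentiable ℝ f) (x y : V) :
    fderiv ℝ (fun y => f (x - y)) y = -fderiv ℝ f (x - y) := by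
  have h := (hf (x - y)).hasFDerivAt.comp y ((hasFDerivAt_id y).const_sub x)
  rw [HasFDerivAt.fderiv (f := fun y => f (x - y)) h]
  ext v
  simp

/-- Integration by parts along rays raises the degree of the kernel. -/
lemma IsAngular.smul_rieszConv [Nontrivial V] {P : V → E →L[ℝ] F} (hP : IsAngular μ P) {s : ℂ}
    (hs : 0 < s.re) {f : V → E} (hf : ContDiff ℝ ∞ f) (hf' : HasCompactSupport f) (x : V) :
    s • rieszConv μ P s f x = rieszConv μ (KnappStein.angDeriv P) (s + 1) (fderiv ℝ f) x := by
  have hG : ContDiff ℝ ∞ fun y => f (x - y) := by fun_prop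
  have hGc := hasCompactSupport_comp_sub hf' x
  have key := smul_integral_of_homogeneous (hP.aestronglyMeasurable_rieszKernel s)
    (hP.locallyIntegrable_norm_smul (by linarith))
    (fun t ht y => rieszKernel_smul P hP s ht y) (hG.of_le (by exact_mod_cast le_top)) hGc
    (integrable_clm_apply (hP.locallyIntegrable_rieszKernel hs) hG.continuous hGc)
  rw [rieszConv, key, rieszConv, ← integral_neg]
  refine integral_congr_ae (Eventually.of_forall fun y => ?_)
  have hd : fderiv ℝ (fun y => f (x - y)) y = -fderiv ℝ f (x - y) := by
    exact fderiv_comp_const_sub' (hf.differentiable (by simp)) x y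
  simp only [hd, rieszKernel_angDeriv_apply]
  simp

lemma contDiff_fderiv {f : V → E} (hf : ContDiff ℝ ∞ f) : ContDiff ℝ ∞ (fderiv ℝ f) :=
  hf.fderiv_right (by exact_mod_cast le_rfl)

/-- For an odd symbol the principal value integral is scaling invariant, so integration by parts
along rays is valid at exponent `0` and produces no boundary term. -/
lemma IsAngular.rieszConv_one_of_odd [Nontrivial V] {P : V → E →L[ℝ] F} (hP : IsAngular μ P)
    (hodd : ∀ y, P (-y) = -P y) {g : V → E} (hg : ContDiff ℝ ∞ g) (hg' : HasCompactSupport g)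
    (x : V) : rieszConv μ (KnappStein.angDeriv P) 1 (fderiv ℝ g) x = 0 := by
  have hg1 : ContDiff ℝ 1 g := hg.of_le (by exact_mod_cast le_top)
  set G : V → E := fun y => g (x - y) - g (x + y) with hG_def
  have hG : ContDiff ℝ 1 G := by fun_prop
  have hGc : HasCompactSupport G :=
    (hasCompactSupport_comp_sub hg' x).sub (hg'.comp_homeomorph (Homeomorph.addLeft x))
  have hli := hP.locallyIntegrable_norm_smul (s := 0) (by simp)
  have hint : Integrable (fun y => rieszKernel P 0 y (G y)) μ := by
    obtain ⟨L, hL⟩ := hg1.lipschitzWith_of_hasCompactSupport hg' one_ne_zero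
    have hb := IntegrableOn.integrable_indicator ((hli.integrableOn_isCompact
      hGc.isCompact).norm.const_mul (2 * (L : ℝ))) (isClosed_tsupport G).measurableSet
    refine hb.mono' (aestronglyMeasurable_clm_apply (hP.aestronglyMeasurable_rieszKernel 0)
      hG.continuous) (Eventually.of_forall fun y => ?_)
    by_cases hy : G y = 0
    · simpa [hy] using indicator_nonneg (fun y _ => by positivity) y
    · have hyG : y ∈ tsupport G := subset_closure (Function.mem_support.2 hy)
      rw [indicator_of_mem hyG, norm_smul, norm_norm]
      have h1 : ‖G y‖ ≤ L * (2 * ‖y‖) := by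
        have := hL.dist_le_mul (x - y) (x + y)
        rw [dist_eq_norm, dist_eq_norm, show x - y - (x + y) = (-2 : ℝ) • y by module,
          norm_smul] at this
        simpa using this
      calc ‖rieszKernel P 0 y (G y)‖ ≤ ‖rieszKernel P 0 y‖ * (L * (2 * ‖y‖)) :=
            (rieszKernel P 0 y).le_opNorm_of_le h1
        _ = 2 * L * (‖y‖ * ‖rieszKernel P 0 y‖) := by ring
  have key := smul_integral_of_homogeneous (hP.aestronglyMeasurable_rieszKernel 0) hli
    (fun t ht y => rieszKernel_smul P hP 0 ht y) hG hGc hint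
  rw [zero_smul, eq_comm, neg_eq_zero] at key
  set A : V → F := fun y => rieszKernel P 0 y (fderiv ℝ g (x - y) y) with hA_def
  have hA : Integrable A μ := by
    have := integrable_clm_apply (hP.angDeriv.locallyIntegrable_rieszKernel (s := 0 + 1) (by simp))
      (g := fun y => fderiv ℝ g (x - y))
      ((contDiff_fderiv hg).continuous.comp (continuous_sub_left x))
      (hasCompactSupport_comp_sub (hg'.fderiv ℝ) x)
    simpa only [rieszKernel_angDeriv_apply] using this
  have hsum : ∀ y, rieszKernel P 0 y (fderiv ℝ G y y) = -(A y + A (-y)) := by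
    intro y
    have hd : fderiv ℝ G y = -fderiv ℝ g (x - y) - fderiv ℝ g (x + y) := by
      have hgd : Differentiable ℝ g := hg1.differentiable one_ne_zero
      rw [hG_def, fderiv_fun_sub (by fun_prop) (by fun_prop), fderiv_comp_const_sub' hgd,
        fderiv_comp_add_left]
    simp only [hd, hA_def, rieszKernel, hodd, norm_neg, sub_neg_eq_add]
    simp [smul_sub]
    abel
  rw [integral_congr_ae (Eventually.of_forall hsum), integral_neg, integral_add hA hA.comp_neg,
    integral_neg_eq_self, neg_eq_zero, ← two_smul ℝ, smul_eq_zero] at key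
  have h0 : ∫ y, A y ∂μ = 0 := key.resolve_left two_ne_zero
  rw [← h0, rieszConv]
  refine integral_congr_ae (Eventually.of_forall fun y => ?_)
  have := rieszKernel_angDeriv_apply P 0 y (fderiv ℝ g (x - y))
  rwa [zero_add] at this

/-! ### Analytic continuation -/

lemma isOpen_halfPlane (a : ℝ) : IsOpen {s : ℂ | a < s.re} :=
  isOpen_lt continuous_const Complex.continuous_re

/-- Two holomorphic functions on a half plane that agree on a smaller half plane are equal. -/
lemma eqOn_halfPlane [CompleteSpace F] {g h : ℂ → F} {a b : ℝ}
    (hg : DifferentiableOn ℂ g {s | a < s.re}) (hh : DifferentiableOn ℂ h {s | a < s.re})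
    (hgh : ∀ s : ℂ, b < s.re → g s = h s) : EqOn g h {s | a < s.re} := by
  have hpre : IsPreconnected {s : ℂ | a < s.re} :=
    ((convex_Ioi a).is_linear_preimage Complex.reLm.isLinear).isPreconnected
  refine (hg.analyticOnNhd (isOpen_halfPlane a)).eqOn_of_preconnected_of_eventuallyEq
    (hh.analyticOnNhd (isOpen_halfPlane a)) hpre (z₀ := ((max a b + 1 : ℝ) : ℂ)) ?_ ?_
  · simpa using (le_max_left a b).trans_lt (lt_add_one _)
  · filter_upwards [(isOpen_halfPlane b).mem_nhds (x := ((max a b + 1 : ℝ) : ℂ))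
      (by simpa using (le_max_right a b).trans_lt (lt_add_one _))] with s hs
    exact hgh s hs

lemma eq_of_eq_halfPlane [CompleteSpace F] {g h : ℂ → F} {b : ℝ} (hg : Differentiable ℂ g)
    (hh : Differentiable ℂ h) (hgh : ∀ s : ℂ, b < s.re → g s = h s) : g = h := by
  funext s
  exact eqOn_halfPlane (a := s.re - 1) hg.differentiableOn hh.differentiableOn hgh
    (by simp)

lemma differentiable_inv_Gamma_half : Differentiable ℂ fun s : ℂ => (Complex.Gamma (s / 2))⁻¹ :=
  Complex.differentiable_one_div_Gamma.comp (differentiable_id.div_const 2)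

/-- Continuation of the normalized convolutions with an even symbol to `Re s > -2N`.  In the
inductive step two integrations by parts express the exponent `s` through the exponent `s + 2` and
the factor `(s + 1)⁻¹`, whose pole is removable since odd symbols produce no residue; at `s = -1`
the result is a convolution with a logarithmic kernel, hence still smooth. -/
theorem exists_continuation_halfPlane [Nontrivial V] [CompleteSpace F] (N : ℕ) :
    ∀ {E : Type} [NormedAddCommGroup E] [NormedSpace ℝ E] {P : V → E →L[ℝ] F},
      IsAngular μ P → (∀ y, P (-y) = P y) → ∀ {f : V → E}, ContDiff ℝ ∞ f → HasCompactSupport f →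
      ∃ T : ℂ → V → F,
        (∀ x, DifferentiableOn ℂ (fun s => T s x) {s | -(2 * N : ℝ) < s.re}) ∧
        (∀ s : ℂ, -(2 * N : ℝ) < s.re → ContDiff ℝ ∞ (T s)) ∧
        ∀ s : ℂ, 0 < s.re → ∀ x, T s x = (Complex.Gamma (s / 2))⁻¹ • rieszConv μ P s f x := by
  induction N with
  | zero =>
    intro E _ _ P hP _ f hf hf'
    refine ⟨fun s x => (Complex.Gamma (s / 2))⁻¹ • rieszConv μ P s f x, fun x s hs => ?_,
      fun s hs => ?_, fun s _ x => rfl⟩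
    · have hs' : 0 < s.re := by simpa using hs
      exact (differentiable_inv_Gamma_half.differentiableAt.smul
        (hP.hasDerivAt_rieszConv hs' hf.continuous hf' x).differentiableAt).differentiableWithinAt
    · have hs' : 0 < s.re := by simpa using hs
      exact (contDiff_integral_clm_apply (hP.locallyIntegrable_rieszKernel hs') hf hf').const_smul _
  | succ N ih =>
    intro E _ _ P hP heven f hf hf'
    have hf2 := contDiff_fderiv (contDiff_fderiv hf)
    have hf2' := (hf'.fderiv ℝ).fderiv ℝ
    have hP2 := hP.angDeriv.angDeriv
    have hodd := angDeriv_neg_of_even heven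
    obtain ⟨T, hT1, hT2, hT3⟩ := ih hP2 (angDeriv_neg_of_odd hodd) hf2 hf2'
    set h : V → ℂ → F := fun x s => T (s + 2) x with hh_def
    have hdiff (x : V) : DifferentiableOn ℂ (h x) {s | -(2 * (N + 1 : ℕ) : ℝ) < s.re} := by
      refine (hT1 x).comp (differentiableOn_id.add_const 2) fun s hs => ?_
      simp only [mem_ofPred_eq, Nat.cast_add, Nat.cast_one] at hs
      simp only [mem_ofPred_eq, Complex.add_re, Complex.re_ofNat]
      linarith
    have hzero (x : V) : h x (-1) = 0 := by
      simp only [hh_def]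
      rw [show (-1 + 2 : ℂ) = 1 by norm_num, hT3 1 (by simp) x,
        hP.angDeriv.rieszConv_one_of_odd hodd (contDiff_fderiv hf) (hf'.fderiv ℝ) x, smul_zero]
    refine ⟨fun s x => (2⁻¹ : ℂ) • dslope (h x) (-1) s, fun x => ?_, fun s hs => ?_,
      fun s hs x => ?_⟩
    · refine DifferentiableOn.const_smul ?_ _
      refine (Complex.differentiableOn_dslope ((isOpen_halfPlane _).mem_nhds ?_)).2 (hdiff x)
      simp only [mem_ofPred_eq, Nat.cast_add, Nat.cast_one, Complex.neg_re, Complex.one_re]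
      have : (0 : ℝ) ≤ N := N.cast_nonneg
      linarith
    · refine ContDiff.const_smul _ ?_
      rcases eq_or_ne s (-1) with rfl | hs1
      · have hder (x : V) : HasDerivAt (h x)
            ((Complex.Gamma (1 / 2))⁻¹ • (∫ y, logKernel (angDeriv (angDeriv P)) 1 y
                (fderiv ℝ (fderiv ℝ f) (x - y)) ∂μ) +
              deriv (fun s : ℂ => (Complex.Gamma (s / 2))⁻¹) 1 •
                rieszConv μ (angDeriv (angDeriv P)) 1 (fderiv ℝ (fderiv ℝ f)) x) (-1) := by
          have h1 := differentiable_inv_Gamma_half.differentiableAt.hasDerivAt.smul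
            (hP2.hasDerivAt_rieszConv (s₀ := 1) (by simp) hf2.continuous hf2' x)
          have h2 : HasDerivAt (fun s : ℂ => s + 2) 1 (-1) := (hasDerivAt_id _).add_const 2
          rw [show (1 : ℂ) = -1 + 2 by norm_num] at h1
          have h3 := h1.scomp (-1) h2
          rw [one_smul] at h3
          refine (h3.congr_of_eventuallyEq ?_).congr_deriv (by norm_num)
          filter_upwards [(isOpen_halfPlane (-2)).mem_nhds (x := (-1 : ℂ)) (by simp)] with s hs
          have hs' : -2 < s.re := hs
          exact hT3 (s + 2) (by simp; linarith) x
        simp only [dslope_same, (hder _).deriv]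
        exact ((contDiff_integral_clm_apply (hP2.locallyIntegrable_logKernel (by simp)) hf2
          hf2').const_smul _).add ((contDiff_integral_clm_apply
            (hP2.locallyIntegrable_rieszKernel (by simp)) hf2 hf2').const_smul _)
      · simp only [dslope_of_ne _ hs1, slope, hzero, vsub_eq_sub, sub_zero]
        refine ContDiff.const_smul _ (hT2 (s + 2) ?_)
        simp only [Nat.cast_add, Nat.cast_one] at hs
        simp only [Complex.add_re, Complex.re_ofNat]
        linarith
    · have hs1 : s + 1 ≠ 0 := fun h0 => by
        have := congrArg Complex.re h0
        simp at this
        linarith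
      have hs1' : s ≠ -1 := fun h0 => hs1 (by rw [h0]; ring)
      have e1 := hP.smul_rieszConv hs hf hf' x
      have e2 := hP.angDeriv.smul_rieszConv (s := s + 1) (by simp; linarith) (contDiff_fderiv hf)
        (hf'.fderiv ℝ) x
      simp only [dslope_of_ne _ hs1', slope, hzero, vsub_eq_sub, sub_zero, sub_neg_eq_add]
      rw [hh_def]
      simp only
      rw [hT3 (s + 2) (by simp; linarith) x, show s + 2 = s + 1 + 1 by ring, ← e2, ← e1,
        Complex.one_div_Gamma_eq_self_mul_one_div_Gamma_add_one (s / 2),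
        show (s + 1 + 1) / 2 = s / 2 + 1 by ring]
      simp only [smul_smul]
      congr 1
      field_simp

/-- The normalized convolutions with an even symbol extend to entire functions of the exponent with
values in smooth functions. -/
theorem exists_continuation [Nontrivial V] [CompleteSpace F] {P : V → E →L[ℝ] F}
    (hP : IsAngular μ P) (heven : ∀ y, P (-y) = P y) {f : V → E} (hf : ContDiff ℝ ∞ f)
    (hf' : HasCompactSupport f) :
    ∃ T : ℂ → V → F, (∀ x, Differentiable ℂ fun s => T s x) ∧ (∀ s, ContDiff ℝ ∞ (T s)) ∧
      ∀ s : ℂ, 0 < s.re → ∀ x, T s x = (Complex.Gamma (s / 2))⁻¹ • rieszConv μ P s f x := by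
  choose T hT1 hT2 hT3 using fun N : ℕ => exists_continuation_halfPlane N hP heven hf hf'
  have hcompat (M N : ℕ) (s : ℂ) (hM : -(2 * M : ℝ) < s.re) (hN : -(2 * N : ℝ) < s.re) (x : V) :
      T M s x = T N s x := by
    have h := eqOn_halfPlane (a := max (-(2 * M : ℝ)) (-(2 * N : ℝ))) (b := 0)
      ((hT1 M x).mono fun s hs => (le_max_left (-(2 * M : ℝ)) (-(2 * N : ℝ))).trans_lt hs)
      ((hT1 N x).mono fun s hs => (le_max_right (-(2 * M : ℝ)) (-(2 * N : ℝ))).trans_lt hs)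
      fun s hs => by rw [hT3 M s hs, hT3 N s hs]
    exact h (max_lt hM hN)
  have hN (s : ℂ) : ∃ N : ℕ, -(2 * N : ℝ) < s.re := by
    obtain ⟨N, hN⟩ := exists_nat_gt (-s.re)
    exact ⟨N, by linarith [N.cast_nonneg (α := ℝ)]⟩
  choose N hN using hN
  refine ⟨fun s => T (N s) s, fun x s => ?_, fun s => hT2 _ s (hN s), fun s hs => hT3 _ s hs⟩
  have hnhds := (isOpen_halfPlane (-(2 * N s : ℝ))).mem_nhds (x := s) (hN s)
  refine ((hT1 (N s) x).differentiableAt hnhds).congr_of_eventuallyEq ?_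
  filter_upwards [hnhds] with z hz
  exact hcompat _ _ z (hN z) hz x

/-! ### The value at exponent zero -/

/-- The value at `0` of a continuous family given by normalized bounded integrals vanishes, since
`1 / Γ` has a zero there. -/
lemma eq_zero_of_norm_le {W : ℂ → F} (hW : ContinuousAt W 0) {J : ℝ → F} {C : ℝ}
    (hJ : ∀ ε ∈ Ioo (0 : ℝ) 1, ‖J ε‖ ≤ C)
    (hWJ : ∀ ε ∈ Ioo (0 : ℝ) 1, W ε = (Complex.Gamma ((ε : ℂ) / 2))⁻¹ • J ε) : W 0 = 0 := by
  have hcast : Tendsto (fun ε : ℝ => (ε : ℂ)) (𝓝[>] (0 : ℝ)) (𝓝 0) :=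
    (Complex.continuous_ofReal.tendsto' 0 0 (by simp)).mono_left nhdsWithin_le_nhds
  have h1 : Tendsto (fun ε : ℝ => W ε) (𝓝[>] (0 : ℝ)) (𝓝 (W 0)) := hW.tendsto.comp hcast
  have h2 : Tendsto (fun ε : ℝ => ‖(Complex.Gamma ((ε : ℂ) / 2))⁻¹‖ * C) (𝓝[>] (0 : ℝ)) (𝓝 0) := by
    have h := (differentiable_inv_Gamma_half.continuous.tendsto 0).norm.mul_const C
    simp only [zero_div, Complex.Gamma_zero, inv_zero, norm_zero, zero_mul] at h
    exact h.comp hcast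
  refine tendsto_nhds_unique h1 (squeeze_zero_norm' ?_ h2)
  filter_upwards [Ioo_mem_nhdsGT one_pos] with ε hε
  rw [hWJ ε hε, norm_smul]
  gcongr
  exact hJ ε hε

/-- The value at `0` of a continuous family given by normalized integrals of size at least
`c / ε` is nonzero, since `1 / Γ` has only a simple zero there. -/
lemma ne_zero_of_le_mul {W : ℂ → ℂ} (hW : ContinuousAt W 0) {J : ℝ → ℝ} {c : ℝ} (hc : 0 < c)
    (hJ : ∀ ε ∈ Ioo (0 : ℝ) 1, c ≤ ε * J ε)
    (hWJ : ∀ ε ∈ Ioo (0 : ℝ) 1, W ε = (Complex.Gamma ((ε : ℂ) / 2))⁻¹ * (J ε : ℂ)) :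
    W 0 ≠ 0 := by
  intro h0
  have hcast : Tendsto (fun ε : ℝ => (ε : ℂ)) (𝓝[>] (0 : ℝ)) (𝓝 0) :=
    (Complex.continuous_ofReal.tendsto' 0 0 (by simp)).mono_left nhdsWithin_le_nhds
  have hG : ContinuousAt (fun s : ℂ => Complex.Gamma (s / 2 + 1)) 0 := by
    refine ContinuousAt.comp' (f := fun s : ℂ => s / 2 + 1) ?_ (by fun_prop)
    simpa using Complex.continuousAt_Gamma_one
  have h1 : Tendsto (fun ε : ℝ => ‖Complex.Gamma ((ε : ℂ) / 2 + 1) * W ε‖)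
      (𝓝[>] (0 : ℝ)) (𝓝 0) := by
    have h : Tendsto (fun s : ℂ => ‖Complex.Gamma (s / 2 + 1) * W s‖) (𝓝 0) (𝓝 0) := by
      simpa [h0] using (hG.mul hW).tendsto.norm
    exact h.comp hcast
  have h2 : ∀ᶠ ε : ℝ in 𝓝[>] 0, c / 2 ≤ ‖Complex.Gamma ((ε : ℂ) / 2 + 1) * W ε‖ := by
    filter_upwards [Ioo_mem_nhdsGT one_pos] with ε hε
    have hG0 : Complex.Gamma ((ε : ℂ) / 2 + 1) ≠ 0 :=
      Complex.Gamma_ne_zero_of_re_pos (by simp; linarith [hε.1])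
    have h3 : Complex.Gamma ((ε : ℂ) / 2 + 1) * W ε = ((ε * J ε / 2 : ℝ) : ℂ) := by
      rw [hWJ ε hε, Complex.one_div_Gamma_eq_self_mul_one_div_Gamma_add_one]
      generalize Complex.Gamma ((ε : ℂ) / 2 + 1) = g at hG0
      push_cast
      field_simp
    rw [h3, Complex.norm_real]
    refine le_trans ?_ (le_abs_self _)
    linarith [hJ ε hε]
  linarith [ge_of_tendsto h1 h2]

/-- Homogeneity compares the integral over the unit ball with the one over the annulus
`1/2 ≤ ‖y‖ < 1`: the former is the latter divided by `1 - 2 ^ (-ε) ≤ ε`. -/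
lemma exists_pos_le_mul_integral [Nontrivial V] {q : V → ℝ} (hq : ContinuousOn q {0}ᶜ)
    (hq0 : ∀ y, 0 ≤ q y) {C : ℝ} (hqC : ∀ y, q y ≤ C) (hom : ∀ t : ℝ, 0 < t → ∀ y, q (t • y) = q y)
    {y₀ : V} (hy₀ : y₀ ≠ 0) (hqy : q y₀ ≠ 0) {χ : V → ℝ} (hχ : Continuous χ)
    (hχc : HasCompactSupport χ) (hχ0 : ∀ y, 0 ≤ χ y) (hχ1 : ∀ y ∈ Metric.ball (0 : V) 1, 1 ≤ χ y) :
    ∃ c > 0, ∀ ε ∈ Ioo (0 : ℝ) 1,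
      c ≤ ε * ∫ y, ‖y‖ ^ (ε - finrank ℝ V) * (q y * χ y) ∂μ := by
  have hqm : AEStronglyMeasurable q μ := aestronglyMeasurable_of_continuousOn hq
  have hli (ε : ℝ) (hε : 0 < ε) :
      LocallyIntegrable (fun y => ‖y‖ ^ (ε - finrank ℝ V) * q y) μ := by
    refine ((locallyIntegrable_norm_rpow hε).smul C).mono
      ((measurable_norm.pow_const _).aestronglyMeasurable.mul hqm)
      (Eventually.of_forall fun y => ?_)
    rw [Pi.smul_apply, smul_eq_mul, mul_comm, norm_mul, Real.norm_of_nonneg (hq0 y)]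
    rw [norm_mul]
    gcongr
    exact (hqC y).trans (le_abs_self C)
  have hball (ε : ℝ) (hε : 0 < ε) (r : ℝ) :
      IntegrableOn (fun y => ‖y‖ ^ (ε - finrank ℝ V) * q y) (Metric.ball 0 r) μ :=
    ((hli ε hε).integrableOn_isCompact (isCompact_closedBall 0 r)).mono_set
      Metric.ball_subset_closedBall
  set A : Set V := Metric.ball 0 1 \ Metric.ball 0 (1 / 2) with hA_def
  have hAm : MeasurableSet A := measurableSet_ball.diff measurableSet_ball
  have hnn (ε : ℝ) (y : V) : 0 ≤ ‖y‖ ^ (ε - finrank ℝ V) * q y :=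
    mul_nonneg (by positivity) (hq0 y)
  have hApos : 0 < ∫ y in A, ‖y‖ ^ ((1 : ℝ) - finrank ℝ V) * q y ∂μ := by
    rw [setIntegral_pos_iff_support_of_nonneg_ae (Eventually.of_forall fun y => hnn 1 y)
      ((hball 1 one_pos 1).mono_set sdiff_subset)]
    have hopen : IsOpen ({0}ᶜ ∩ q ⁻¹' {0}ᶜ ∩ (Metric.ball 0 1 \ Metric.closedBall 0 (1 / 2))) :=
      (hq.isOpen_inter_preimage isOpen_compl_singleton isOpen_compl_singleton).inter
        (Metric.isOpen_ball.sdiff Metric.isClosed_closedBall)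
    refine (hopen.measure_pos μ ⟨(3 / 4 * ‖y₀‖⁻¹) • y₀, ⟨?_, ?_⟩, ?_⟩).trans_le (measure_mono ?_)
    · simp [hy₀]
    · have : 0 < 3 / 4 * ‖y₀‖⁻¹ := by have := norm_pos_iff.2 hy₀; positivity
      simpa [hom _ this] using hqy
    · have h : ‖(3 / 4 * ‖y₀‖⁻¹) • y₀‖ = 3 / 4 := by
        rw [norm_smul, norm_mul, norm_inv, norm_norm, mul_assoc,
          inv_mul_cancel₀ (norm_ne_zero_iff.2 hy₀)]
        norm_num
      simp only [Set.mem_sdiff, mem_ball_zero_iff, mem_closedBall_zero_iff, h]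
      norm_num
    · rintro y ⟨⟨h1, h2⟩, h3, h4⟩
      refine ⟨mul_ne_zero (Real.rpow_pos_of_pos (norm_pos_iff.2 h1) _).ne' h2, h3, fun h5 => h4 ?_⟩
      exact Metric.ball_subset_closedBall h5
  refine ⟨_, hApos, fun ε hε => ?_⟩
  set I := ∫ y in Metric.ball (0 : V) 1, ‖y‖ ^ (ε - finrank ℝ V) * q y ∂μ with hI_def
  have hI0 : 0 ≤ I := integral_nonneg fun y => hnn ε y
  have hhalf : ∫ y in Metric.ball (0 : V) (1 / 2), ‖y‖ ^ (ε - finrank ℝ V) * q y ∂μ =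
      (1 / 2 : ℝ) ^ ε * I := by
    have h := Measure.setIntegral_comp_smul_of_pos μ
      (fun y => ‖y‖ ^ (ε - finrank ℝ V) * q y) (Metric.ball (0 : V) 1) one_half_pos
    rw [smul_unitBall_of_pos one_half_pos] at h
    have h' : ∀ y : V, ‖(1 / 2 : ℝ) • y‖ ^ (ε - finrank ℝ V) * q ((1 / 2 : ℝ) • y) =
        (1 / 2 : ℝ) ^ (ε - finrank ℝ V) * (‖y‖ ^ (ε - finrank ℝ V) * q y) := by
      intro y
      rw [hom _ one_half_pos, norm_smul, Real.norm_of_nonneg one_half_pos.le,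
        Real.mul_rpow one_half_pos.le (norm_nonneg _), mul_assoc]
    simp only [h', integral_const_mul] at h
    rw [Real.rpow_sub one_half_pos, Real.rpow_natCast, smul_eq_mul, ← hI_def] at h
    have h0 : (1 / 2 : ℝ) ^ finrank ℝ V ≠ 0 := by positivity
    field_simp at h
    rw [← h]
  have hann : ∫ y in A, ‖y‖ ^ (ε - finrank ℝ V) * q y ∂μ = I - (1 / 2 : ℝ) ^ ε * I := by
    rw [hA_def, setIntegral_sdiff measurableSet_ball (hball ε hε.1 1)
      (Metric.ball_subset_ball (by norm_num)), hhalf]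
  have hle1 : ∫ y in A, ‖y‖ ^ ((1 : ℝ) - finrank ℝ V) * q y ∂μ ≤
      ∫ y in A, ‖y‖ ^ (ε - finrank ℝ V) * q y ∂μ := by
    refine setIntegral_mono_on ((hball 1 one_pos 1).mono_set sdiff_subset)
      ((hball ε hε.1 1).mono_set sdiff_subset) hAm fun y hy => ?_
    have h1 : ‖y‖ ≤ 1 := (mem_ball_zero_iff.1 hy.1).le
    have h2 : 0 < ‖y‖ := by
      have : ¬ ‖y‖ < 1 / 2 := fun h => hy.2 (mem_ball_zero_iff.2 h)
      linarith
    exact mul_le_mul_of_nonneg_right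
      (Real.rpow_le_rpow_of_exponent_ge h2 h1 (by linarith [hε.2])) (hq0 y)
  have hexp : 1 - (1 / 2 : ℝ) ^ ε ≤ ε := by
    have h1 := Real.add_one_le_exp (Real.log (1 / 2) * ε)
    rw [← Real.rpow_def_of_pos one_half_pos] at h1
    have h2 : -1 ≤ Real.log (1 / 2) := by
      have := Real.one_sub_inv_le_log_of_pos (one_half_pos (α := ℝ))
      norm_num at this ⊢
      linarith
    nlinarith [hε.1]
  have hle2 : I ≤ ∫ y, ‖y‖ ^ (ε - finrank ℝ V) * (q y * χ y) ∂μ := by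
    have hint : Integrable (fun y => ‖y‖ ^ (ε - finrank ℝ V) * (q y * χ y)) μ := by
      have := (hli ε hε.1).integrable_smul_left_of_hasCompactSupport hχ hχc
      refine this.congr (Eventually.of_forall fun y => ?_)
      simp only [smul_eq_mul]
      ring
    refine le_trans (setIntegral_mono_on (hball ε hε.1 1) hint.integrableOn measurableSet_ball
      fun y hy => ?_) (setIntegral_le_integral hint (Eventually.of_forall fun y => ?_))
    · rw [← mul_assoc]
      exact le_mul_of_one_le_right (hnn ε y) (hχ1 y hy)
    · exact mul_nonneg (by positivity) (mul_nonneg (hq0 y) (hχ0 y))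
  calc _ ≤ I - (1 / 2 : ℝ) ^ ε * I := hle1.trans_eq hann
    _ = (1 - (1 / 2 : ℝ) ^ ε) * I := by ring
    _ ≤ ε * I := by gcongr
    _ ≤ _ := by gcongr; exact hε.1.le

lemma IsAngular.integrableOn_ball_rieszKernel_apply [Nontrivial V] {P : V → E →L[ℝ] F}
    (hP : IsAngular μ P) {ε : ℝ} (hε : 0 < ε) (e : E) :
    IntegrableOn (fun y => rieszKernel P ε y e) (Metric.ball 0 1) μ :=
  ((ContinuousLinearMap.apply ℝ F e).integrable_comp
    ((hP.locallyIntegrable_rieszKernel (s := (ε : ℂ)) (by simpa using hε)).integrableOn_isCompact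
      (isCompact_closedBall (0 : V) 1))).mono_measure
    (Measure.restrict_mono_set _ Metric.ball_subset_closedBall)

/-- If the symbol has mean zero over the unit ball, the convolutions stay bounded as the exponent
tends to `0`: the value `f x` may be subtracted inside the unit ball. -/
lemma IsAngular.exists_norm_rieszConv_le [Nontrivial V] {P : V → E →L[ℝ] F} (hP : IsAngular μ P)
    (hmean : ∀ ε : ℝ, 0 < ε → ∀ e, ∫ y in Metric.ball 0 1, rieszKernel P ε y e ∂μ = 0)
    {f : V → E} (hf : ContDiff ℝ 1 f) (hf' : HasCompactSupport f) (x : V) :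
    ∃ C, ∀ ε ∈ Ioo (0 : ℝ) 1, ‖rieszConv μ P ε f x‖ ≤ C := by
  obtain ⟨C, hC0, hC⟩ := hP.exists_nonneg_bound
  obtain ⟨L, hL⟩ := hf.lipschitzWith_of_hasCompactSupport hf' one_ne_zero
  obtain ⟨M, hM⟩ := hf.continuous.bounded_above_of_compact_support hf'
  have hM0 : 0 ≤ M := (norm_nonneg _).trans (hM 0)
  have hcs := hasCompactSupport_comp_sub hf' x
  have hcont : Continuous fun y => f (x - y) := by have := hf.continuous; fun_prop
  obtain ⟨R, hR⟩ := hcs.isCompact.isBounded.subset_closedBall 0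
  set b : V → ℝ := (Metric.closedBall (0 : V) (max R 1)).indicator fun y =>
    C * (L + M) * (‖y‖ ^ ((1 : ℝ) - finrank ℝ V) + ‖y‖ ^ ((2 : ℝ) - finrank ℝ V)) with hb_def
  have hb : Integrable b μ :=
    IntegrableOn.integrable_indicator ((((locallyIntegrable_norm_rpow one_pos).add
      (locallyIntegrable_norm_rpow two_pos)).integrableOn_isCompact
        (isCompact_closedBall 0 (max R 1))).const_mul _) measurableSet_closedBall
  refine ⟨∫ y, b y ∂μ, fun ε hε => ?_⟩
  have hli := hP.locallyIntegrable_rieszKernel (s := (ε : ℂ)) (by simpa using hε.1)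
  have hI1 := integrable_clm_apply hli hcont hcs
  have hI2 := hP.integrableOn_ball_rieszKernel_apply hε.1 (f x)
  have heq : rieszConv μ P ε f x = ∫ y, (rieszKernel P ε y (f (x - y)) -
      (Metric.ball (0 : V) 1).indicator (fun y => rieszKernel P ε y (f x)) y) ∂μ := by
    rw [integral_sub hI1 (hI2.integrable_indicator measurableSet_ball),
      integral_indicator measurableSet_ball, hmean ε hε.1, sub_zero, rieszConv]
  rw [heq]
  refine norm_integral_le_of_norm_le hb ?_
  filter_upwards [ae_ne_zero] with y hy
  have hy' := norm_pos_iff.2 hy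
  have hsub : ‖f (x - y) - (Metric.ball (0 : V) 1).indicator (fun _ => f x) y‖ ≤
      (Metric.closedBall (0 : V) (max R 1)).indicator (fun y => (L + M) * ‖y‖) y := by
    by_cases h1 : y ∈ Metric.ball (0 : V) 1
    · have h2 : y ∈ Metric.closedBall (0 : V) (max R 1) :=
        Metric.closedBall_subset_closedBall (le_max_right _ _) (Metric.ball_subset_closedBall h1)
      rw [indicator_of_mem h1, indicator_of_mem h2]
      have h3 := hL.dist_le_mul (x - y) x
      rw [dist_eq_norm, dist_eq_norm, sub_sub_cancel_left, norm_neg] at h3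
      nlinarith
    · rw [indicator_of_notMem h1, sub_zero]
      have h3 : 1 ≤ ‖y‖ := by simpa using h1
      by_cases h4 : f (x - y) = 0
      · rw [h4, norm_zero]
        exact indicator_nonneg (fun y _ => by positivity) y
      · have h2 : y ∈ Metric.closedBall (0 : V) (max R 1) :=
          Metric.closedBall_subset_closedBall (le_max_left _ _)
            (hR (subset_closure (Function.mem_support.2 h4)))
        rw [indicator_of_mem h2]
        have := hM (x - y)
        have hL0 : (0 : ℝ) ≤ L := L.2
        nlinarith
  have hlin : rieszKernel P ε y (f (x - y)) -
      (Metric.ball (0 : V) 1).indicator (fun y => rieszKernel P ε y (f x)) y =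
      rieszKernel P ε y (f (x - y) - (Metric.ball (0 : V) 1).indicator (fun _ => f x) y) := by
    by_cases h1 : y ∈ Metric.ball (0 : V) 1 <;> simp [h1]
  rw [hlin]
  refine ((rieszKernel P ε y).le_opNorm_of_le hsub).trans ?_
  by_cases h2 : y ∈ Metric.closedBall (0 : V) (max R 1)
  · rw [hb_def, indicator_of_mem h2, indicator_of_mem h2, norm_rieszKernel hy, Complex.ofReal_re]
    have hpow : ‖y‖ ^ (ε - finrank ℝ V) * ‖y‖ ≤
        ‖y‖ ^ ((1 : ℝ) - finrank ℝ V) + ‖y‖ ^ ((2 : ℝ) - finrank ℝ V) := by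
      rw [← Real.rpow_add_one hy'.ne']
      rcases le_total ‖y‖ 1 with h | h
      · have := Real.rpow_le_rpow_of_exponent_ge hy' h
          (show (1 : ℝ) - finrank ℝ V ≤ ε - finrank ℝ V + 1 by linarith [hε.1])
        have : 0 ≤ ‖y‖ ^ ((2 : ℝ) - finrank ℝ V) := by positivity
        linarith
      · have := Real.rpow_le_rpow_of_exponent_le h
          (show ε - finrank ℝ V + 1 ≤ (2 : ℝ) - finrank ℝ V by linarith [hε.2])
        have : 0 ≤ ‖y‖ ^ ((1 : ℝ) - finrank ℝ V) := by positivity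
        linarith
    calc ‖y‖ ^ (ε - finrank ℝ V) * ‖P y‖ * ((L + M) * ‖y‖)
        = ‖P y‖ * (L + M) * (‖y‖ ^ (ε - finrank ℝ V) * ‖y‖) := by ring
      _ ≤ _ := by
        gcongr
        exact hC y
  · rw [hb_def, indicator_of_notMem h2, indicator_of_notMem h2, mul_zero]

/-! ### Scalar symbols -/

/-- A real-valued function on `V` as a symbol, acting on scalar functions by multiplication. -/
def scalarSymbol (q : V → ℝ) (y : V) : ℝ →L[ℝ] ℂ := q y • Complex.ofRealCLM

lemma rieszKernel_scalarSymbol_apply (q : V → ℝ) (s : ℂ) (y : V) (r : ℝ) :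
    rieszKernel (scalarSymbol q) s y r =
      (‖y‖ : ℂ) ^ (s - (finrank ℝ V : ℂ)) * ((q y * r : ℝ) : ℂ) := by
  change (‖y‖ : ℂ) ^ (s - (finrank ℝ V : ℂ)) * (q y • (r : ℂ)) = _
  rw [Complex.real_smul, Complex.ofReal_mul]

lemma isAngular_scalarSymbol [Nontrivial V] {q : V → ℝ} (hq : ContinuousOn q {0}ᶜ) {C : ℝ}
    (hqC : ∀ y, |q y| ≤ C) (hom : ∀ t : ℝ, 0 < t → ∀ y, q (t • y) = q y) :
    IsAngular μ (scalarSymbol q) where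
  aestronglyMeasurable := (aestronglyMeasurable_of_continuousOn hq).smul_const _
  exists_bound := by
    refine ⟨C, fun y => ?_⟩
    rw [scalarSymbol, norm_smul, Complex.ofRealCLM_norm, mul_one]
    exact hqC y
  map_smul t ht y := by rw [scalarSymbol, scalarSymbol, hom t ht]

/-- A nonnegative symbol gives a nonzero normalized integral at exponent `0`, where it is the mass
of the symbol on the sphere up to a positive factor. -/
lemma scalar_continuation_zero_ne_zero [Nontrivial V] {q : V → ℝ} (hq : ContinuousOn q {0}ᶜ)
    (hq0 : ∀ y, 0 ≤ q y) {C : ℝ} (hqC : ∀ y, q y ≤ C) (hom : ∀ t : ℝ, 0 < t → ∀ y, q (t • y) = q y)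
    {y₀ : V} (hy₀ : y₀ ≠ 0) (hqy : q y₀ ≠ 0) {χ : V → ℝ} (hχ : Continuous χ)
    (hχc : HasCompactSupport χ) (hχ0 : ∀ y, 0 ≤ χ y) (hχ1 : ∀ y ∈ Metric.ball (0 : V) 1, 1 ≤ χ y)
    {W : ℂ → ℂ} (hW : Differentiable ℂ W)
    (hWc : ∀ s : ℂ, 0 < s.re →
      W s = (Complex.Gamma (s / 2))⁻¹ * rieszConv μ (scalarSymbol q) s χ 0) :
    W 0 ≠ 0 := by
  obtain ⟨c, hc, hle⟩ := exists_pos_le_mul_integral (μ := μ) hq hq0 hqC hom hy₀ hqy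
    (χ := fun y => χ (0 - y)) (by fun_prop) (hasCompactSupport_comp_sub hχc 0) (fun y => hχ0 _)
    (fun y hy => hχ1 _ (by simpa using hy))
  refine ne_zero_of_le_mul hW.continuous.continuousAt hc hle fun ε hε => ?_
  rw [hWc ε (by simpa using hε.1), rieszConv, ← integral_complex_ofReal]
  congr 2
  funext y
  rw [rieszKernel_scalarSymbol_apply, Complex.ofReal_mul (‖y‖ ^ _),
    Complex.ofReal_cpow (norm_nonneg _)]
  push_cast
  rfl

/-- Some test function detects a nonzero scalar kernel. -/
lemma exists_rieszConv_scalarSymbol_ne_zero [Nontrivial V] {q : V → ℝ}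
    (hq : ContinuousOn q {0}ᶜ) (hP : IsAngular μ (scalarSymbol q)) {y₀ : V} (hy₀ : y₀ ≠ 0)
    (hqy : q y₀ ≠ 0) {s : ℂ} (hs : 0 < s.re) :
    ∃ χ : V → ℝ, ContDiff ℝ ∞ χ ∧ HasCompactSupport χ ∧
      rieszConv μ (scalarSymbol q) s χ 0 ≠ 0 := by
  by_contra! H
  -- Otherwise the locally integrable kernel is orthogonal to all test functions.
  have hli : LocallyIntegrable (fun y => rieszKernel (scalarSymbol q) s y 1) μ := fun x =>
    (ContinuousLinearMap.apply ℝ ℂ (1 : ℝ)).integrableAtFilter_comp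
      (hP.locallyIntegrable_rieszKernel hs x)
  have hae := ae_eq_zero_of_integral_contDiff_smul_eq_zero hli fun g hg hgc => by
    have h := H (fun y => g (0 - y)) (by fun_prop) (hasCompactSupport_comp_sub hgc 0)
    rw [rieszConv] at h
    rw [← h]
    refine integral_congr_ae (Eventually.of_forall fun y => ?_)
    simp only [rieszKernel_scalarSymbol_apply, Complex.real_smul]
    rw [zero_sub, zero_sub, neg_neg]
    push_cast
    ring
  have hopen : IsOpen ({0}ᶜ ∩ q ⁻¹' {0}ᶜ) :=
    hq.isOpen_inter_preimage isOpen_compl_singleton isOpen_compl_singleton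
  refine (hopen.measure_pos μ ⟨y₀, hy₀, hqy⟩).ne' (measure_mono_null ?_ hae)
  rintro y ⟨h1, h2⟩ h3
  have h1' : (‖y‖ : ℂ) ≠ 0 := by simpa using h1
  have h4 : rieszKernel (scalarSymbol q) s y 1 = 0 := h3
  rw [rieszKernel_scalarSymbol_apply, mul_one, mul_eq_zero, Complex.cpow_eq_zero_iff] at h4
  rcases h4 with h4 | h4
  · exact h1' h4.1
  · exact h2 (Complex.ofReal_eq_zero.1 h4)

end General

variable {n i : ℕ}

/-! ### The Knapp-Stein family -/

/-- On vectors, `ᵗψₙ(y)` is the reflection in the hyperplane orthogonal to `y`. -/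
lemma toEuclideanCLM_psi (y v : Rn n) :
    Matrix.toEuclideanCLM (𝕜 := ℝ) (psi y)ᵀ v = v - (2 / ‖y‖ ^ 2 * inner ℝ y v) • y := by
  ext k
  have h : inner ℝ y v = ∑ l, y l * v l := by
    simp [PiLp.inner_apply, mul_comm]
  simp only [psi, Matrix.transpose_sub, Matrix.transpose_one, Matrix.transpose_smul,
    Matrix.transpose_vecMulVec, map_sub, map_one, map_smul]
  simp [h, Matrix.ofLp_toEuclideanCLM, Matrix.vecMulVec_mulVec, dotProduct]
  ring

/-- The angular symbol of the Knapp-Stein kernel on `i`-forms. -/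
def formSymbol (n i : ℕ) (y : Rn n) : Form n i →L[ℝ] Form n i :=
  (sigma i (psi y)).restrictScalars ℝ

lemma formSymbol_apply (y : Rn n) (α : Form n i) :
    formSymbol n i y α = α.compContinuousLinearMap (Matrix.toEuclideanCLM (𝕜 := ℝ) (psi y)ᵀ) :=
  rfl

lemma psi_smul {t : ℝ} (ht : t ≠ 0) (y : Rn n) : psi (t • y) = psi y := by
  have h : (2 / ‖t • y‖ ^ 2) * (t * t) = 2 / ‖y‖ ^ 2 := by
    rw [norm_smul, mul_pow, Real.norm_eq_abs, sq_abs]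
    field_simp
  rw [psi, psi, ← h]
  simp [Matrix.smul_vecMulVec, Matrix.vecMulVec_smul, smul_smul]

lemma norm_toEuclideanCLM_psi_le (y : Rn n) :
    ‖Matrix.toEuclideanCLM (𝕜 := ℝ) (psi y)ᵀ‖ ≤ 3 := by
  refine ContinuousLinearMap.opNorm_le_bound _ (by norm_num) fun v => ?_
  rw [toEuclideanCLM_psi]
  have h : ‖(2 / ‖y‖ ^ 2 * inner ℝ y v) • y‖ ≤ 2 * ‖v‖ := by
    rcases eq_or_ne y 0 with rfl | hy
    · simp
    have hy' := norm_pos_iff.2 hy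
    rw [norm_smul, norm_mul, Real.norm_of_nonneg (by positivity)]
    calc 2 / ‖y‖ ^ 2 * ‖inner ℝ y v‖ * ‖y‖ ≤ 2 / ‖y‖ ^ 2 * (‖y‖ * ‖v‖) * ‖y‖ := by
          gcongr
          exact norm_inner_le_norm y v
      _ = 2 * ‖v‖ := by field_simp
  linarith [norm_sub_le v ((2 / ‖y‖ ^ 2 * inner ℝ y v) • y)]

lemma continuousOn_toEuclideanCLM_psi :
    ContinuousOn (fun y : Rn n => Matrix.toEuclideanCLM (𝕜 := ℝ) (psi y)ᵀ) {0}ᶜ := by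
  rw [continuousOn_clm_apply]
  intro v
  simp only [toEuclideanCLM_psi]
  have h1 : Continuous fun y : Rn n => ‖y‖ ^ 2 := by fun_prop
  have h2 : Continuous fun y : Rn n => (inner ℝ y v : ℝ) := by fun_prop
  refine continuousOn_const.sub (((continuousOn_const.div h1.continuousOn fun y hy => ?_).mul
    h2.continuousOn).smul continuousOn_id)
  exact pow_ne_zero _ (norm_ne_zero_iff.2 hy)

lemma isAngular_formSymbol [NeZero n] : IsAngular volume (formSymbol n i) where
  aestronglyMeasurable := by
    refine aestronglyMeasurable_of_continuousOn ?_
    exact ContinuousAlternatingMap.continuous_compContinuousLinearMapCLM.comp_continuousOn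
      continuousOn_toEuclideanCLM_psi
  exists_bound := by
    refine ⟨3 ^ i, fun y => ContinuousLinearMap.opNorm_le_bound _ (by positivity) fun α => ?_⟩
    rw [formSymbol_apply, mul_comm]
    refine (α.norm_compContinuousLinearMap_le _).trans ?_
    rw [Fintype.card_fin]
    gcongr
    exact norm_toEuclideanCLM_psi_le y
  map_smul t ht y := by rw [formSymbol, formSymbol, psi_smul ht.ne']

lemma formSymbol_neg (y : Rn n) : formSymbol n i (-y) = formSymbol n i y := by
  rw [formSymbol, formSymbol, ← psi_smul (t := -1) (by norm_num) y, neg_one_smul]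

lemma conv_eq_rieszConv (lam : ℂ) (f : Rn n → Form n i) (x : Rn n) :
    conv n i lam f x = (Complex.Gamma ((2 * lam - n) / 2))⁻¹ •
      rieszConv volume (formSymbol n i) (2 * lam - n) f x := by
  rw [conv, rieszConv, ← integral_smul]
  refine integral_congr_ae (Eventually.of_forall fun y => ?_)
  change ((Complex.Gamma (lam - n / 2))⁻¹ * (‖y‖ : ℂ) ^ (2 * (lam - n))) •
    formSymbol n i y (f (x - y)) = (Complex.Gamma ((2 * lam - n) / 2))⁻¹ •
      ((‖y‖ : ℂ) ^ (2 * lam - n - (finrank ℝ (Rn n) : ℂ))) • formSymbol n i y (f (x - y))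
  rw [smul_smul, finrank_euclideanSpace_fin]
  congr 3 <;> ring_nf

lemma re_two_mul_sub_pos {lam : ℂ} (h : (n : ℝ) / 2 < lam.re) : 0 < (2 * lam - n : ℂ).re := by
  simp
  linarith

lemma differentiable_two_mul_sub : Differentiable ℂ fun lam : ℂ => 2 * lam - n := by fun_prop

theorem existsUnique_isKnappSteinFamily [NeZero n] :
    ∃! T : ℂ → CompactForms n i →ₗ[ℂ] SmoothForms n i, IsKnappSteinFamily n i T := by
  choose S hS1 hS2 hS3 using fun f : CompactForms n i =>
    exists_continuation (isAngular_formSymbol (i := i)) formSymbol_neg f.2.1 f.2.2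
  have hint (s : ℂ) (hs : 0 < s.re) (f : CompactForms n i) (x : Rn n) :
      Integrable fun y => rieszKernel (formSymbol n i) s y ((f : Rn n → Form n i) (x - y)) :=
    integrable_clm_apply (isAngular_formSymbol.locallyIntegrable_rieszKernel hs)
      (f.2.1.continuous.comp (continuous_sub_left x)) (hasCompactSupport_comp_sub f.2.2 x)
  have hadd (f g : CompactForms n i) (s : ℂ) (x : Rn n) : S (f + g) s x = S f s x + S g s x := by
    refine congrFun (eq_of_eq_halfPlane (b := 0) (hS1 (f + g) x) ((hS1 f x).add (hS1 g x))
      fun s hs => ?_) s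
    simp only [Pi.add_apply, hS3 _ s hs]
    rw [← smul_add, rieszConv, rieszConv, rieszConv, ← integral_add (hint s hs f x) (hint s hs g x)]
    congr 2
    ext1 y
    exact map_add _ _ _
  have hsmul (c : ℂ) (f : CompactForms n i) (s : ℂ) (x : Rn n) : S (c • f) s x = c • S f s x := by
    refine congrFun (eq_of_eq_halfPlane (b := 0) (hS1 (c • f) x) ((hS1 f x).const_smul c)
      fun s hs => ?_) s
    simp only [Pi.smul_apply, hS3 _ s hs]
    rw [smul_comm]
    congr 1
    rw [rieszConv, rieszConv, ← integral_smul]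
    refine integral_congr_ae (Eventually.of_forall fun y => ?_)
    change (‖y‖ : ℂ) ^ (s - (finrank ℝ (Rn n) : ℂ)) • sigma i (psi y) (c • f.1 (x - y)) =
      c • (‖y‖ : ℂ) ^ (s - (finrank ℝ (Rn n) : ℂ)) • sigma i (psi y) (f.1 (x - y))
    rw [map_smul, smul_comm]
  refine ⟨fun lam =>
    { toFun := fun f => ⟨S f (2 * lam - n), hS2 f (2 * lam - n)⟩
      map_add' := fun f g => Subtype.ext (funext fun x => hadd f g _ x)
      map_smul' := fun c f => Subtype.ext (funext fun x => hsmul c f _ x) },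
    ⟨fun f x => ?_, fun lam hlam f => ?_⟩, fun T hT => ?_⟩
  · exact (hS1 f x).comp differentiable_two_mul_sub
  · funext x
    rw [conv_eq_rieszConv]
    exact hS3 f _ (re_two_mul_sub_pos hlam) x
  · funext lam
    refine LinearMap.ext fun f => Subtype.ext (funext fun x => ?_)
    refine congrFun (eq_of_eq_halfPlane (b := (n : ℝ) / 2) (hT.holomorphic f x)
      ((hS1 f x).comp differentiable_two_mul_sub) fun lam hlam => ?_) lam
    rw [hT.eq_conv lam hlam f, conv_eq_rieszConv]
    exact (hS3 f _ (re_two_mul_sub_pos hlam) x).symm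

/-! ### The mean value of the symbol -/

/-- Modifying all arguments of an alternating map by multiples of one vector has only first-order
effects. -/
lemma _root_.AlternatingMap.map_add_smul_same {R M N ι : Type*} [CommRing R] [AddCommGroup M]
    [Module R M] [AddCommGroup N] [Module R N] [Fintype ι] [DecidableEq ι]
    (α : M [⋀^ι]→ₗ[R] N) (c : ι → R) (w : M) (v : ι → M) :
    α (fun a => v a + c a • w) = α v + ∑ a, c a • α (Function.update v a w) := by
  have key : ∀ (s : Finset ι) (v : ι → M), α (fun a => if a ∈ s then v a + c a • w else v a) =
      α v + ∑ a ∈ s, c a • α (Function.update v a w) := by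
    intro s
    induction s using Finset.induction_on with
    | empty => simp
    | insert b s hb ih =>
      intro v
      set u : ι → M := fun a => if a ∈ s then v a + c a • w else v a with hu
      have h1 : (fun a => if a ∈ insert b s then v a + c a • w else v a) =
          Function.update u b (v b + c b • w) := by
        funext a
        rcases eq_or_ne a b with rfl | hab <;> simp [*]
      have h2 : Function.update u b (v b) = u := by
        rw [Function.update_eq_self_iff]
        simp [hu, hb]
      have h3 : Function.update u b w = fun a => if a ∈ s then
          Function.update v b w a + c a • w else Function.update v b w a := by
        funext a
        rcases eq_or_ne a b with rfl | hab <;> simp [*]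
      have h4 : α (Function.update u b w) = α (Function.update v b w) := by
        rw [h3, ih, add_eq_left]
        refine Finset.sum_eq_zero fun a ha => ?_
        have hab : a ≠ b := fun h => hb (h ▸ ha)
        rw [α.map_eq_zero_of_eq _ (i := a) (j := b) _ hab, smul_zero]
        simp [Function.update_of_ne hab.symm]
      rw [h1, α.map_update_add, α.map_update_smul, h2, h4, ih, Finset.sum_insert hb]
      abel
  simpa using key Finset.univ v

/-- The standard basis vectors of `ℝⁿ`. -/
abbrev stdVec (k : Fin n) : Rn n := EuclideanSpace.single k 1

lemma sum_smul_stdVec (y : Rn n) : y = ∑ l, y l • stdVec l := by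
  have h := (EuclideanSpace.basisFun (Fin n) ℝ).sum_repr y
  simpa using h.symm

lemma formSymbol_apply_stdVec (y : Rn n) (α : Form n i) (K : Fin i → Fin n) :
    formSymbol n i y α (fun a => stdVec (K a)) = α (fun a => stdVec (K a)) -
      ∑ a, ∑ l, (2 / ‖y‖ ^ 2 * (y (K a) * y l) : ℝ) •
        α (Function.update (fun a => stdVec (K a)) a (stdVec l)) := by
  have h1 : formSymbol n i y α (fun a => stdVec (K a)) =
      α (fun a => stdVec (K a) + (-(2 / ‖y‖ ^ 2 * y (K a))) • y) := by
    rw [formSymbol_apply, ContinuousAlternatingMap.compContinuousLinearMap_apply]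
    congr 1
    funext a
    rw [Function.comp_apply, toEuclideanCLM_psi, neg_smul, ← sub_eq_add_neg]
    simp [EuclideanSpace.inner_single_right]
  rw [h1]
  have h2 := α.toAlternatingMap.map_add_smul_same (fun a => -(2 / ‖y‖ ^ 2 * y (K a))) y
    (fun a => stdVec (K a))
  simp only [ContinuousAlternatingMap.coe_toAlternatingMap] at h2
  rw [h2, sub_eq_add_neg, ← Finset.sum_neg_distrib]
  congr 1
  refine Finset.sum_congr rfl fun a _ => ?_
  have h3 : α (Function.update (fun a => stdVec (K a)) a y) =
      ∑ l, y l • α (Function.update (fun a => stdVec (K a)) a (stdVec l)) := by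
    conv_lhs => rw [sum_smul_stdVec y]
    have := α.toAlternatingMap.toMultilinearMap.map_update_sum Finset.univ a
      (fun l => y l • stdVec l) (fun a => stdVec (K a))
    simp only [MultilinearMap.map_update_smul] at this
    exact this
  rw [h3, Finset.smul_sum, ← Finset.sum_neg_distrib]
  refine Finset.sum_congr rfl fun l _ => ?_
  module

/-- The isometry of `ℝⁿ` that changes the sign of one coordinate. -/
def flipCoord (j : Fin n) : Rn n ≃ₗᵢ[ℝ] Rn n :=
  LinearIsometryEquiv.piLpCongrRight 2 fun k =>
    if k = j then LinearIsometryEquiv.neg ℝ else LinearIsometryEquiv.refl ℝ ℝ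

lemma flipCoord_apply (j k : Fin n) (y : Rn n) :
    flipCoord j y k = if k = j then -y k else y k := by
  by_cases h : k = j <;> simp [flipCoord, h]

lemma integral_radial_mul_of_ne (φ : ℝ → ℂ) {j l : Fin n} (h : j ≠ l) :
    ∫ y : Rn n, φ ‖y‖ * ((y j * y l : ℝ) : ℂ) = 0 := by
  have h1 := (flipCoord j).measurePreserving.integral_comp
    (flipCoord j).toHomeomorph.measurableEmbedding
    (fun y : Rn n => φ ‖y‖ * ((y j * y l : ℝ) : ℂ))
  simp only [LinearIsometryEquiv.norm_map, flipCoord_apply, if_neg h.symm, if_true] at h1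
  have h2 : (fun y : Rn n => φ ‖y‖ * ((-y j * y l : ℝ) : ℂ)) =
      fun y => -(φ ‖y‖ * ((y j * y l : ℝ) : ℂ)) := by
    funext y
    push_cast
    ring
  rw [h2, integral_neg] at h1
  exact self_eq_neg.1 h1.symm

lemma integral_radial_mul_self [NeZero n] (φ : ℝ → ℂ)
    (hφ : ∀ j, Integrable fun y : Rn n => φ ‖y‖ * ((y j * y j : ℝ) : ℂ)) (j : Fin n) :
    ∫ y : Rn n, φ ‖y‖ * ((y j * y j : ℝ) : ℂ) = (n : ℂ)⁻¹ * ∫ y : Rn n, φ ‖y‖ * (‖y‖ ^ 2 : ℝ) := by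
  have hsymm (l : Fin n) : ∫ y : Rn n, φ ‖y‖ * ((y l * y l : ℝ) : ℂ) =
      ∫ y : Rn n, φ ‖y‖ * ((y j * y j : ℝ) : ℂ) := by
    set e : Rn n ≃ₗᵢ[ℝ] Rn n := LinearIsometryEquiv.piLpCongrLeft 2 ℝ ℝ (Equiv.swap j l)
    have he (y : Rn n) : e y j = y l := by
      simp [e, LinearIsometryEquiv.piLpCongrLeft_apply, Equiv.piCongrLeft']
    have h1 := e.measurePreserving.integral_comp e.toHomeomorph.measurableEmbedding
      (fun y : Rn n => φ ‖y‖ * ((y j * y j : ℝ) : ℂ))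
    simpa only [LinearIsometryEquiv.norm_map, he] using h1
  have hsum : ∫ y : Rn n, φ ‖y‖ * (‖y‖ ^ 2 : ℝ) =
      ∑ l, ∫ y : Rn n, φ ‖y‖ * ((y l * y l : ℝ) : ℂ) := by
    rw [← integral_finsetSum _ fun l _ => hφ l]
    congr 1
    funext y
    rw [← Finset.mul_sum, EuclideanSpace.real_norm_sq_eq]
    push_cast
    simp only [sq]
  rw [hsum, Finset.sum_congr rfl fun l _ => hsymm l, Finset.sum_const, Finset.card_univ,
    Fintype.card_fin, nsmul_eq_mul, inv_mul_cancel_left₀ (Nat.cast_ne_zero.2 (NeZero.ne n))]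

/-- The mean value `1 - 2i/n` of the form symbol. -/
def meanSymbol (n i : ℕ) : ℝ := 1 - 2 * i / n

/-- The form symbol with its mean value subtracted. -/
def centeredSymbol (n i : ℕ) (y : Rn n) : Form n i →L[ℝ] Form n i :=
  formSymbol n i y - meanSymbol n i • ContinuousLinearMap.id ℝ (Form n i)

lemma isAngular_const {V E F : Type} [NormedAddCommGroup V] [NormedSpace ℝ V] [MeasurableSpace V]
    [NormedAddCommGroup E] [NormedSpace ℝ E] [NormedAddCommGroup F] [NormedSpace ℝ F]
    {μ : Measure V} (A : E →L[ℝ] F) : IsAngular μ fun _ : V => A :=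
  ⟨aestronglyMeasurable_const, ⟨‖A‖, fun _ => le_rfl⟩, fun _ _ _ => rfl⟩

lemma isAngular_centeredSymbol [NeZero n] : IsAngular volume (centeredSymbol n i) where
  aestronglyMeasurable :=
    isAngular_formSymbol.aestronglyMeasurable.sub aestronglyMeasurable_const
  exists_bound := by
    obtain ⟨C, hC⟩ := (isAngular_formSymbol (n := n) (i := i)).exists_bound
    exact ⟨_, fun y => (norm_sub_le _ _).trans (add_le_add_left (hC y) _)⟩
  map_smul t ht y := by
    rw [centeredSymbol, centeredSymbol, isAngular_formSymbol.map_smul t ht]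

lemma ext_stdVec {α β : Form n i}
    (h : ∀ K : Fin i → Fin n, α (fun a => stdVec (K a)) = β (fun a => stdVec (K a))) : α = β := by
  refine ContinuousAlternatingMap.toAlternatingMap_injective
    (Basis.ext_alternating (EuclideanSpace.basisFun (Fin n) ℝ).toBasis fun K _ => ?_)
  simpa using h K

/-- The kernel with centered symbol has mean zero over the unit ball: off-diagonal second moments of
a radial weight vanish by reflection, and the diagonal ones agree by permuting coordinates. -/
lemma setIntegral_centeredSymbol [NeZero n] {ε : ℝ} (hε : 0 < ε) (α : Form n i) :
    ∫ y in Metric.ball 0 1, rieszKernel (centeredSymbol n i) ε y α = 0 := by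
  refine ext_stdVec fun K => ?_
  have h1 := (ContinuousAlternatingMap.apply ℝ (Rn n) ℂ
    (fun a => stdVec (K a))).integral_comp_comm
      (isAngular_centeredSymbol.integrableOn_ball_rieszKernel_apply hε α)
  refine h1.symm.trans ?_
  -- The radial factor of the kernel, cut off at the unit sphere.
  set φ : ℝ → ℂ := fun r => if r < 1 then (r : ℂ) ^ ((ε : ℂ) - n) * (2 / r ^ 2 : ℝ) else 0
    with hφ_def
  have hφm : Measurable φ := by
    refine Measurable.ite measurableSet_Iio ?_ measurable_const
    exact (Complex.measurable_ofReal.pow_const _).mul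
      (Complex.measurable_ofReal.comp ((measurable_id.pow_const 2).const_div 2))
  have hint (g : Rn n → ℝ) (hg : Measurable g) (hle : ∀ y, |g y| ≤ ‖y‖ ^ 2) :
      Integrable fun y : Rn n => φ ‖y‖ * ((g y : ℝ) : ℂ) := by
    have hb : Integrable ((Metric.closedBall (0 : Rn n) 1).indicator
        fun y => 2 * ‖y‖ ^ (ε - finrank ℝ (Rn n))) volume :=
      IntegrableOn.integrable_indicator (((locallyIntegrable_norm_rpow hε).integrableOn_isCompact
        (isCompact_closedBall 0 1)).const_mul 2) measurableSet_closedBall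
    refine hb.mono' ((hφm.comp measurable_norm).mul
      (Complex.measurable_ofReal.comp hg)).aestronglyMeasurable ?_
    filter_upwards [ae_ne_zero] with y hy
    have hy' := norm_pos_iff.2 hy
    by_cases h : ‖y‖ < 1
    · rw [indicator_of_mem (mem_closedBall_zero_iff.2 h.le), hφ_def, finrank_euclideanSpace_fin]
      simp only [if_pos h, norm_mul, Complex.norm_real, norm_ofReal_norm_cpow hy, Real.norm_eq_abs]
      have hre : ((ε : ℂ) - n).re = ε - n := by simp
      rw [hre, abs_of_pos (a := 2 / ‖y‖ ^ 2) (by positivity)]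
      calc ‖y‖ ^ (ε - n) * (2 / ‖y‖ ^ 2) * |g y| ≤ ‖y‖ ^ (ε - n) * (2 / ‖y‖ ^ 2) * ‖y‖ ^ 2 := by
            gcongr
            exact hle y
        _ = 2 * ‖y‖ ^ (ε - n) := by field_simp
    · simp only [hφ_def, if_neg h, zero_mul, norm_zero]
      exact indicator_nonneg (fun y _ => by positivity) y
  have hcoord (y : Rn n) (j : Fin n) : |y j| ≤ ‖y‖ := by
    simpa using PiLp.norm_apply_le y j
  have hint2 (j l : Fin n) : Integrable fun y : Rn n => φ ‖y‖ * ((y j * y l : ℝ) : ℂ) := by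
    refine hint _ (by fun_prop) fun y => ?_
    rw [abs_mul, sq]
    exact mul_le_mul (hcoord y j) (hcoord y l) (abs_nonneg _) (norm_nonneg _)
  have hint3 : Integrable fun y : Rn n => φ ‖y‖ * ((‖y‖ ^ 2 : ℝ) : ℂ) :=
    hint _ (by fun_prop) fun y => (abs_of_nonneg (by positivity)).le
  have hexp : ∀ y : Rn n, y ≠ 0 → (Metric.ball (0 : Rn n) 1).indicator (fun y =>
      rieszKernel (centeredSymbol n i) ε y α (fun a => stdVec (K a))) y =
      φ ‖y‖ * (‖y‖ ^ 2 : ℝ) * (i / n * α (fun a => stdVec (K a))) -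
        ∑ a, ∑ l, φ ‖y‖ * (y (K a) * y l : ℝ) *
          α (Function.update (fun a => stdVec (K a)) a (stdVec l)) := by
    intro y hy
    by_cases h : ‖y‖ < 1
    · rw [indicator_of_mem (mem_ball_zero_iff.2 h)]
      have h2 : rieszKernel (centeredSymbol n i) ε y α (fun a => stdVec (K a)) =
          (‖y‖ : ℂ) ^ ((ε : ℂ) - (finrank ℝ (Rn n) : ℂ)) *
            (formSymbol n i y α (fun a => stdVec (K a)) -
              meanSymbol n i • α (fun a => stdVec (K a))) := rfl
      have hy0 : (‖y‖ : ℂ) ≠ 0 := by simpa using hy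
      rw [h2, formSymbol_apply_stdVec, finrank_euclideanSpace_fin]
      simp only [hφ_def, if_pos h, meanSymbol, Complex.real_smul, mul_sub, Finset.mul_sum]
      push_cast
      rw [sub_right_comm]
      congr 1
      · field_simp
        ring
      · refine Finset.sum_congr rfl fun a _ => Finset.sum_congr rfl fun l _ => ?_
        ring
    · rw [indicator_of_notMem (fun h' => h (mem_ball_zero_iff.1 h'))]
      simp [hφ_def, if_neg h]
  change ∫ y in Metric.ball 0 1,
    rieszKernel (centeredSymbol n i) ε y α (fun a => stdVec (K a)) = 0
  rw [← integral_indicator measurableSet_ball,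
    integral_congr_ae (ae_ne_zero.mono hexp), integral_sub (hint3.mul_const _)
      (integrable_finsetSum _ fun a _ => integrable_finsetSum _ fun l _ =>
        (hint2 (K a) l).mul_const _),
    integral_finsetSum _ fun a _ => integrable_finsetSum _ fun l _ =>
        (hint2 (K a) l).mul_const _]
  have hterm (a : Fin i) : ∫ y : Rn n, ∑ l, φ ‖y‖ * (y (K a) * y l : ℝ) *
      α (Function.update (fun a => stdVec (K a)) a (stdVec l)) =
      (n : ℂ)⁻¹ * (∫ y : Rn n, φ ‖y‖ * (‖y‖ ^ 2 : ℝ)) * α (fun a => stdVec (K a)) := by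
    rw [integral_finsetSum _ fun l _ => (hint2 (K a) l).mul_const _, Finset.sum_eq_single (K a)]
    · rw [integral_mul_const, integral_radial_mul_self φ (fun j => hint2 j j),
        Function.update_eq_self]
    · intro l _ hl
      rw [integral_mul_const, integral_radial_mul_of_ne φ hl.symm, zero_mul]
    · simp
  simp only [hterm, integral_mul_const, Finset.sum_const, Finset.card_univ, Fintype.card_fin,
    nsmul_eq_mul]
  ring

/-! ### Vanishing and nonvanishing -/

lemma IsKnappSteinFamily.apply_eq_rieszConv {T : ℂ → CompactForms n i →ₗ[ℂ] SmoothForms n i}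
    (hT : IsKnappSteinFamily n i T) (f : CompactForms n i) (x : Rn n) {s : ℂ} (hs : 0 < s.re) :
    (T ((s + n) / 2) f : Rn n → Form n i) x =
      (Complex.Gamma (s / 2))⁻¹ • rieszConv volume (formSymbol n i) s f x := by
  rw [hT.eq_conv _ (by simp; linarith) f, conv_eq_rieszConv,
    show 2 * ((s + n) / 2) - (n : ℂ) = s by ring]

lemma IsKnappSteinFamily.differentiable_shift {T : ℂ → CompactForms n i →ₗ[ℂ] SmoothForms n i}
    (hT : IsKnappSteinFamily n i T) (f : CompactForms n i) (x : Rn n) :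
    Differentiable ℂ fun s : ℂ => (T ((s + n) / 2) f : Rn n → Form n i) x :=
  (hT.holomorphic f x).comp ((differentiable_id.add_const _).div_const 2)

/-- At `lam = n / 2` the operator is the mean value `1 - 2i/n` of its symbol times the corresponding
operator for the symbol `1`. -/
lemma IsKnappSteinFamily.apply_half [NeZero n]
    {T : ℂ → CompactForms n i →ₗ[ℂ] SmoothForms n i} (hT : IsKnappSteinFamily n i T)
    (f : CompactForms n i) (x : Rn n) {U : ℂ → Form n i} (hU : Differentiable ℂ U)
    (hUc : ∀ s : ℂ, 0 < s.re → U s = (Complex.Gamma (s / 2))⁻¹ •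
      rieszConv volume (fun _ : Rn n => ContinuousLinearMap.id ℝ (Form n i)) s f x) :
    (T (n / 2) f : Rn n → Form n i) x = (meanSymbol n i : ℂ) • U 0 := by
  obtain ⟨C, hC⟩ := isAngular_centeredSymbol.exists_norm_rieszConv_le
    (fun ε hε α => setIntegral_centeredSymbol hε α)
    (f.2.1.of_le (by exact_mod_cast le_top)) f.2.2 x
  have hW := ((hT.differentiable_shift f x).sub (hU.const_smul (meanSymbol n i : ℂ)))
  have h0 := eq_zero_of_norm_le hW.continuous.continuousAt hC fun ε hε => by
    have hε' : 0 < (ε : ℂ).re := by simpa using hε.1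
    have hint {P : Rn n → Form n i →L[ℝ] Form n i} (hP : IsAngular volume P) :
        Integrable fun y => rieszKernel P ε y (f.1 (x - y)) :=
      integrable_clm_apply (hP.locallyIntegrable_rieszKernel hε')
        (f.2.1.continuous.comp (continuous_sub_left x)) (hasCompactSupport_comp_sub f.2.2 x)
    have hint' : Integrable fun y => (meanSymbol n i : ℂ) •
        rieszKernel (fun _ : Rn n => ContinuousLinearMap.id ℝ (Form n i)) ε y (f.1 (x - y)) :=
      (hint (isAngular_const (ContinuousLinearMap.id ℝ (Form n i)))).smul (meanSymbol n i : ℂ)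
    have hsub : rieszConv volume (centeredSymbol n i) ε f x =
        rieszConv volume (formSymbol n i) ε f x - (meanSymbol n i : ℂ) •
          rieszConv volume (fun _ : Rn n => ContinuousLinearMap.id ℝ (Form n i)) ε f x := by
      rw [rieszConv, rieszConv, rieszConv, ← integral_smul,
        ← integral_sub (hint isAngular_formSymbol) hint']
      refine integral_congr_ae (Eventually.of_forall fun y => ?_)
      change (‖y‖ : ℂ) ^ ((ε : ℂ) - (finrank ℝ (Rn n) : ℂ)) •
        (formSymbol n i y (f.1 (x - y)) - meanSymbol n i • f.1 (x - y)) =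
        (‖y‖ : ℂ) ^ ((ε : ℂ) - (finrank ℝ (Rn n) : ℂ)) • formSymbol n i y (f.1 (x - y)) -
          (meanSymbol n i : ℂ) • (‖y‖ : ℂ) ^ ((ε : ℂ) - (finrank ℝ (Rn n) : ℂ)) • f.1 (x - y)
      rw [smul_sub, smul_comm (meanSymbol n i : ℂ)]
      congr 2
    simp only [Pi.sub_apply, Pi.smul_apply]
    rw [hT.apply_eq_rieszConv f x hε', hUc ε hε', hsub, smul_sub, smul_comm]
  simp only [Pi.sub_apply, Pi.smul_apply, zero_add] at h0
  exact sub_eq_zero.1 h0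

/-- The form `dx₁ ∧ ⋯ ∧ dxᵢ`, as the minor of the first `i` coordinates. -/
def minorForm (hi : i ≤ n) : Form n i :=
  Complex.ofRealCLM.compContinuousAlternatingMap
    { toMultilinearMap := (Matrix.detRowAlternating.compLinearMap
        ((LinearMap.funLeft ℝ ℝ (Fin.castLE hi)).comp
          (EuclideanSpace.equiv (Fin n) ℝ).toLinearMap)).toMultilinearMap
      cont := by
        change Continuous fun v : Fin i → Rn n =>
          Matrix.det (Matrix.of fun a b => v a (Fin.castLE hi b))
        fun_prop
      map_eq_zero_of_eq' := (Matrix.detRowAlternating.compLinearMap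
        ((LinearMap.funLeft ℝ ℝ (Fin.castLE hi)).comp
          (EuclideanSpace.equiv (Fin n) ℝ).toLinearMap)).map_eq_zero_of_eq' }

lemma minorForm_apply (hi : i ≤ n) (v : Fin i → Rn n) :
    minorForm hi v = ((Matrix.of fun a b => v a (Fin.castLE hi b)).det : ℝ) :=
  rfl

/-- The first `i` standard basis vectors. -/
def frame (hi : i ≤ n) (a : Fin i) : Rn n := stdVec (Fin.castLE hi a)

lemma minorForm_frame (hi : i ≤ n) : minorForm hi (frame hi) = 1 := by
  have h : (Matrix.of fun a b => frame hi a (Fin.castLE hi b) : Matrix (Fin i) (Fin i) ℝ) = 1 := by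
    ext a b
    simp [frame, Matrix.one_apply, eq_comm]
  rw [minorForm_apply, h, Matrix.det_one, Complex.ofReal_one]

/-- The quadratic form `‖y‖² - 2 (y₁² + ⋯ + yᵢ²)`, the matrix coefficient of `‖y‖² σ(ψₙ(y))` at
`dx₁ ∧ ⋯ ∧ dxᵢ`. -/
def coeffForm (hi : i ≤ n) (y : Rn n) : ℝ := ‖y‖ ^ 2 - 2 * ∑ a, y (Fin.castLE hi a) ^ 2

lemma formSymbol_minorForm_frame (hi : i ≤ n) {y : Rn n} (hy : y ≠ 0) :
    formSymbol n i y (minorForm hi) (frame hi) = (coeffForm hi y / ‖y‖ ^ 2 : ℝ) := by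
  rw [formSymbol_apply, ContinuousAlternatingMap.compContinuousLinearMap_apply, minorForm_apply]
  congr 1
  set u : Fin i → ℝ := fun a => y (Fin.castLE hi a) with hu
  have hM : (Matrix.of fun a b => (Matrix.toEuclideanCLM (𝕜 := ℝ) (psi y)ᵀ ∘ frame hi) a
      (Fin.castLE hi b) : Matrix (Fin i) (Fin i) ℝ) =
      1 + Matrix.replicateCol Unit (-(2 / ‖y‖ ^ 2) • u) * Matrix.replicateRow Unit u := by
    ext a b
    rw [Matrix.of_apply, Function.comp_apply, toEuclideanCLM_psi]
    simp [frame, Matrix.one_apply, Matrix.mul_apply, hu, EuclideanSpace.inner_single_right,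
      eq_comm]
    ring
  rw [hM, Matrix.det_one_add_replicateCol_mul_replicateRow, coeffForm, dotProduct_smul]
  have hy' : ‖y‖ ≠ 0 := norm_ne_zero_iff.2 hy
  simp only [dotProduct, hu, smul_eq_mul, ← sq]
  field_simp
  ring

/-- The square of the matrix coefficient of `σ(ψₙ(y))` at `dx₁ ∧ ⋯ ∧ dxᵢ`. -/
def coeffSq (hi : i ≤ n) (y : Rn n) : ℝ := (coeffForm hi y / ‖y‖ ^ 2) ^ 2

lemma contDiff_coeffForm (hi : i ≤ n) : ContDiff ℝ ∞ (coeffForm hi) := by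
  have h : ContDiff ℝ ∞ fun y : Rn n => ‖y‖ ^ 2 := contDiff_norm_sq ℝ
  have h2 (k : Fin n) : ContDiff ℝ ∞ fun y : Rn n => y k := by fun_prop
  exact h.sub (contDiff_const.mul (ContDiff.sum fun a _ => (h2 _).pow 2))

lemma coeffForm_smul (hi : i ≤ n) (t : ℝ) (y : Rn n) :
    coeffForm hi (t • y) = t ^ 2 * coeffForm hi y := by
  simp only [coeffForm, norm_smul, mul_pow, Real.norm_eq_abs, sq_abs, PiLp.smul_apply, smul_eq_mul,
    ← Finset.mul_sum]
  ring

lemma coeffSq_smul (hi : i ≤ n) {t : ℝ} (ht : t ≠ 0) (y : Rn n) :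
    coeffSq hi (t • y) = coeffSq hi y := by
  rw [coeffSq, coeffForm_smul, norm_smul, mul_pow, Real.norm_eq_abs, sq_abs,
    mul_div_mul_left _ _ (pow_ne_zero 2 ht), coeffSq]

lemma continuousOn_coeffSq (hi : i ≤ n) : ContinuousOn (coeffSq hi) {0}ᶜ :=
  ((contDiff_coeffForm hi).continuous.continuousOn.div (by fun_prop)
    fun y hy => pow_ne_zero _ (norm_ne_zero_iff.2 hy)).pow 2

lemma coeffSq_nonneg (hi : i ≤ n) (y : Rn n) : 0 ≤ coeffSq hi y := sq_nonneg _

lemma coeffSq_le (hi : i ≤ n) (y : Rn n) : coeffSq hi y ≤ (1 + 2 * i) ^ 2 := by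
  have h1 : ∑ a, y (Fin.castLE hi a) ^ 2 ≤ i * ‖y‖ ^ 2 := by
    refine (Finset.sum_le_card_nsmul _ _ (‖y‖ ^ 2) fun a _ => ?_).trans_eq (by simp)
    rw [← sq_abs]
    have := PiLp.norm_apply_le y (Fin.castLE hi a)
    rw [Real.norm_eq_abs] at this
    gcongr
  have h0 : 0 ≤ ∑ a, y (Fin.castLE hi a) ^ 2 := Finset.sum_nonneg fun a _ => sq_nonneg _
  rw [coeffSq, ← sq_abs, abs_div, abs_of_nonneg (a := ‖y‖ ^ 2) (by positivity)]
  gcongr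
  refine div_le_of_le_mul₀ (by positivity) (by positivity) ?_
  have hi0 : (0 : ℝ) ≤ i := i.cast_nonneg
  rw [coeffForm, abs_le]
  constructor <;> nlinarith [sq_nonneg ‖y‖]

lemma coeffSq_stdVec_ne_zero (hi : i ≤ n) (k : Fin n) : coeffSq hi (stdVec k) ≠ 0 := by
  have h : coeffForm hi (stdVec k) =
      ((1 - 2 * (Finset.univ.filter fun a : Fin i => Fin.castLE hi a = k).card : ℤ) : ℝ) := by
    have h1 (a : Fin i) : (stdVec k (Fin.castLE hi a) : ℝ) ^ 2 =
        if Fin.castLE hi a = k then 1 else 0 := by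
      by_cases h : Fin.castLE hi a = k <;> simp [h]
    rw [coeffForm, Finset.sum_congr rfl fun a _ => h1 a]
    simp
  have h2 : coeffForm hi (stdVec k) ≠ 0 := by
    rw [h]
    intro h0
    have h3 := Int.cast_eq_zero.1 h0
    omega
  simpa [coeffSq] using h2

lemma isAngular_coeffSq [NeZero n] (hi : i ≤ n) :
    IsAngular volume (scalarSymbol (coeffSq hi)) :=
  isAngular_scalarSymbol (continuousOn_coeffSq hi)
    (fun y => (abs_of_nonneg (coeffSq_nonneg hi y)).trans_le (coeffSq_le hi y))
    fun _ ht y => coeffSq_smul hi ht.ne' y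

lemma stdVec_ne_zero (k : Fin n) : stdVec k ≠ 0 := by simp

/-- The compactly supported form `g(y) dx₁ ∧ ⋯ ∧ dxᵢ`. -/
def testForm (hi : i ≤ n) (g : Rn n → ℝ) (hg : ContDiff ℝ ∞ g) (hg' : HasCompactSupport g) :
    CompactForms n i :=
  ⟨fun y => g y • minorForm hi, hg.smul contDiff_const,
    hg'.comp_left (g := fun r : ℝ => r • minorForm hi)
      (ContinuousAlternatingMap.ext fun v => zero_smul ℝ (minorForm hi v))⟩

/-- A matrix coefficient of a form-valued convolution is a scalar convolution. -/
lemma rieszConv_testForm_apply [NeZero n] (hi : i ≤ n) {P : Rn n → Form n i →L[ℝ] Form n i}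
    (hP : IsAngular volume P) {g χ : Rn n → ℝ} (hg : ContDiff ℝ ∞ g) (hg' : HasCompactSupport g)
    {q : Rn n → ℝ} {k : ℕ} (h : ∀ y : Rn n, y ≠ 0 →
      g (-y) • P y (minorForm hi) (frame hi) = ((‖y‖ ^ (2 * k) * (q y * χ (-y)) : ℝ) : ℂ))
    {s : ℂ} (hs : 0 < s.re) :
    rieszConv volume P s (testForm hi g hg hg') 0 (frame hi) =
      rieszConv volume (scalarSymbol q) (s + 2 * k) χ 0 := by
  have hint := integrable_clm_apply (hP.locallyIntegrable_rieszKernel hs)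
    ((testForm hi g hg hg').2.1.continuous.comp (continuous_sub_left 0))
    (hasCompactSupport_comp_sub (testForm hi g hg hg').2.2 0)
  refine ((ContinuousAlternatingMap.apply ℝ (Rn n) ℂ (frame hi)).integral_comp_comm hint).symm.trans
    (integral_congr_ae (ae_ne_zero.mono fun y hy => ?_))
  have hy0 : (‖y‖ : ℂ) ≠ 0 := by simpa using hy
  have h1 : rieszKernel P s y (g (0 - y) • minorForm hi) (frame hi) =
      (‖y‖ : ℂ) ^ (s - (finrank ℝ (Rn n) : ℂ)) • (g (-y) • P y (minorForm hi) (frame hi)) := by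
    rw [map_smul, zero_sub, smul_comm]
    rfl
  change rieszKernel P s y (g (0 - y) • minorForm hi) (frame hi) =
    rieszKernel (scalarSymbol q) (s + 2 * k) y (χ (0 - y))
  rw [h1, h y hy, rieszKernel_scalarSymbol_apply, add_sub_right_comm, Complex.cpow_add _ _ hy0,
    zero_sub, smul_eq_mul, show (2 * k : ℂ) = ((2 * k : ℕ) : ℂ) by push_cast; rfl,
    Complex.cpow_natCast]
  push_cast
  ring

lemma differentiable_apply_frame (hi : i ≤ n) {S : ℂ → Form n i} (hS : Differentiable ℂ S) :
    Differentiable ℂ fun s => S s (frame hi) := by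
  let ev : Form n i →L[ℂ] ℂ :=
    { toFun := fun α => α (frame hi)
      map_add' := fun _ _ => rfl
      map_smul' := fun _ _ => rfl
      cont := (ContinuousAlternatingMap.apply ℝ (Rn n) ℂ (frame hi)).continuous }
  exact ev.differentiable.comp hS

/-- A smooth cutoff function equal to `1` on the unit ball. -/
lemma exists_cutoff (n : ℕ) : ∃ χ : Rn n → ℝ, ContDiff ℝ ∞ χ ∧ HasCompactSupport χ ∧
    (∀ y, 0 ≤ χ y) ∧ ∀ y ∈ Metric.ball (0 : Rn n) 1, 1 ≤ χ y := by
  let b : ContDiffBump (0 : Rn n) := ⟨1, 2, one_pos, one_lt_two⟩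
  exact ⟨b, b.contDiff, b.hasCompactSupport, fun y => b.nonneg, fun y hy =>
    (b.one_of_mem_closedBall (Metric.ball_subset_closedBall hy)).ge⟩

/-- If the mean value is nonzero, the operator at `n / 2` is detected by a cutoff function times
`dx₁ ∧ ⋯ ∧ dxᵢ`. -/
lemma IsKnappSteinFamily.half_eq_zero_iff [NeZero n] (hi : i ≤ n)
    {T : ℂ → CompactForms n i →ₗ[ℂ] SmoothForms n i} (hT : IsKnappSteinFamily n i T) :
    T (n / 2) = 0 ↔ meanSymbol n i = 0 := by
  have hU (f : CompactForms n i) := exists_continuation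
    (isAngular_const (μ := (volume : Measure (Rn n))) (ContinuousLinearMap.id ℝ (Form n i)))
    (fun _ => rfl) f.2.1 f.2.2
  refine ⟨fun h => ?_, fun h => LinearMap.ext fun f => Subtype.ext (funext fun x => ?_)⟩
  · obtain ⟨χ, hχ, hχc, hχ0, hχ1⟩ := exists_cutoff n
    obtain ⟨U, hU1, -, hU3⟩ := hU (testForm hi χ hχ hχc)
    have h1 := hT.apply_half (testForm hi χ hχ hχc) 0 (hU1 0) fun s hs => hU3 s hs 0
    rw [h] at h1
    have h2 : U 0 0 (frame hi) ≠ 0 := by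
      refine scalar_continuation_zero_ne_zero (μ := (volume : Measure (Rn n))) (q := fun _ => 1)
        (C := 1) (W := fun s => U s 0 (frame hi)) continuousOn_const (fun _ => zero_le_one)
        (fun _ => le_rfl) (fun _ _ _ => rfl) (stdVec_ne_zero 0) one_ne_zero hχ.continuous hχc hχ0
        hχ1 (differentiable_apply_frame hi (hU1 0)) fun s hs => ?_
      have h3 := rieszConv_testForm_apply hi (isAngular_const (μ := (volume : Measure (Rn n)))
        (ContinuousLinearMap.id ℝ (Form n i))) hχ hχc (q := fun _ => 1) (k := 0) (χ := χ)
        (fun y _ => by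
          change χ (-y) • minorForm hi (frame hi) = _
          rw [minorForm_frame]
          simp) hs
      rw [hU3 s hs 0]
      change _ * rieszConv (F := Form n i) _ _ _ _ _ (frame hi) = _
      rw [h3]
      simp
    have h3 : (meanSymbol n i : ℂ) * U 0 0 (frame hi) = 0 :=
      (congrArg (fun α : Form n i => α (frame hi)) h1).symm
    exact Complex.ofReal_eq_zero.1 ((mul_eq_zero.1 h3).resolve_right h2)
  · obtain ⟨U, hU1, -, hU3⟩ := hU f
    rw [hT.apply_half f x (hU1 x) fun s hs => hU3 s hs x, h, Complex.ofReal_zero]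
    exact zero_smul ℂ (U 0 x)

/-- On `χ(y) ‖y‖ ^ (2 (k - 1)) coeffForm(y) dx₁ ∧ ⋯ ∧ dxᵢ` the family has the matrix coefficient
`(s / 2) (s / 2 + 1) ⋯ (s / 2 + k - 1)` times the continued integral of `χ` against the
nonnegative kernel `‖y‖ ^ (s + 2 k - n) coeffSq(y)`. -/
lemma IsKnappSteinFamily.apply_testForm [NeZero n] (hi : i ≤ n)
    {T : ℂ → CompactForms n i →ₗ[ℂ] SmoothForms n i} (hT : IsKnappSteinFamily n i T) {k : ℕ}
    (hk : k ≠ 0) {χ : Rn n → ℝ} (hχ : ContDiff ℝ ∞ χ) (hχc : HasCompactSupport χ) {W : ℂ → ℂ}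
    (hW : Differentiable ℂ W) (hWc : ∀ s : ℂ, 0 < s.re → W s =
      (Complex.Gamma (s / 2))⁻¹ * rieszConv volume (scalarSymbol (coeffSq hi)) s χ 0) :
    ∃ f : CompactForms n i, ∀ s : ℂ, (T ((s + n) / 2) f : Rn n → Form n i) 0 (frame hi) =
      (ascPochhammer ℂ k).eval (s / 2) * W (s + 2 * k) := by
  obtain ⟨m, rfl⟩ := Nat.exists_eq_succ_of_ne_zero hk
  set g : Rn n → ℝ := fun y => χ y * ((‖y‖ ^ 2) ^ m * coeffForm hi y) with hg_def
  have hg : ContDiff ℝ ∞ g :=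
    hχ.mul (((contDiff_norm_sq ℝ).pow m).mul (contDiff_coeffForm hi))
  have hgc : HasCompactSupport g := hχc.mul_right
  refine ⟨testForm hi g hg hgc, fun s => ?_⟩
  refine congrFun (eq_of_eq_halfPlane (b := 0)
    (differentiable_apply_frame hi (hT.differentiable_shift (testForm hi g hg hgc) 0))
    (((ascPochhammer ℂ (m + 1)).differentiable.comp (differentiable_id.div_const 2)).mul
      (hW.comp (differentiable_id.add_const _))) fun s hs => ?_) s
  have h1 := rieszConv_testForm_apply hi (isAngular_formSymbol (n := n) (i := i)) hg hgc
    (q := coeffSq hi) (k := m + 1) (χ := χ) (fun y hy => by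
      have hy' : ‖y‖ ≠ 0 := norm_ne_zero_iff.2 hy
      have h2 : coeffForm hi (-y) = coeffForm hi y := by
        simpa using coeffForm_smul hi (-1) y
      rw [formSymbol_minorForm_frame hi hy, hg_def, Complex.real_smul, ← Complex.ofReal_mul]
      simp only [h2, norm_neg, coeffSq]
      congr 1
      field_simp
      ring) hs
  have hre : 0 < (s + 2 * ((m + 1 : ℕ) : ℂ)).re := by
    have h0 : (0 : ℝ) ≤ m := m.cast_nonneg
    simp
    linarith
  have hG : Complex.Gamma (s / 2 + (m + 1 : ℕ)) ≠ 0 :=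
    Complex.Gamma_ne_zero_of_re_pos (by
      have h0 : (0 : ℝ) ≤ m := m.cast_nonneg
      simp
      linarith)
  have hpoch := Complex.Gamma_add_nat_div_Gamma_eq (n := m + 1) (s / 2) fun j hj => by
    have := congrArg Complex.re hj
    have h0 : (0 : ℝ) ≤ j := j.cast_nonneg
    simp at this
    linarith
  rw [hT.apply_eq_rieszConv _ 0 hs]
  change (Complex.Gamma (s / 2))⁻¹ * rieszConv (F := Form n i) _ _ _ _ _ (frame hi) =
    (ascPochhammer ℂ (m + 1)).eval (s / 2) * W (s + 2 * ((m + 1 : ℕ) : ℂ))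
  rw [h1, hWc _ hre, ← hpoch,
    show (s + 2 * ((m + 1 : ℕ) : ℂ)) / 2 = s / 2 + (m + 1 : ℕ) by ring]
  generalize Complex.Gamma (s / 2 + (m + 1 : ℕ)) = γ at hG
  field_simp

lemma IsKnappSteinFamily.ne_zero [NeZero n] (hi : i ≤ n)
    {T : ℂ → CompactForms n i →ₗ[ℂ] SmoothForms n i} (hT : IsKnappSteinFamily n i T) {s : ℂ}
    (hs : s ≠ 0) : T ((s + n) / 2) ≠ 0 := by
  intro h0
  have hcont (χ : Rn n → ℝ) (hχ : ContDiff ℝ ∞ χ) (hχc : HasCompactSupport χ) :=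
    exists_continuation (isAngular_coeffSq hi) (fun y => by
      rw [scalarSymbol, scalarSymbol, ← coeffSq_smul hi (t := -1) (by norm_num) y, neg_one_smul])
      hχ hχc
  have hzero {k : ℕ} (hk : k ≠ 0) {χ : Rn n → ℝ} (hχ : ContDiff ℝ ∞ χ) (hχc : HasCompactSupport χ)
      {W : ℂ → ℂ} (hW : Differentiable ℂ W) (hWc : ∀ s : ℂ, 0 < s.re → W s =
        (Complex.Gamma (s / 2))⁻¹ * rieszConv volume (scalarSymbol (coeffSq hi)) s χ 0)
      (hpoch : (ascPochhammer ℂ k).eval (s / 2) ≠ 0) : W (s + 2 * k) = 0 := by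
    obtain ⟨f, hf⟩ := hT.apply_testForm hi hk hχ hχc hW hWc
    have h := hf s
    rw [h0] at h
    exact (mul_eq_zero.1 h.symm).resolve_left hpoch
  -- At a pole `s = -2k` of `Γ(s / 2)` the test form of order `k` moves the exponent to `0`; elsewhere
  -- a test form of high order moves it into the half plane of local integrability.
  by_cases hpole : ∃ k : ℕ, s = -(2 * k)
  · obtain ⟨k, rfl⟩ := hpole
    have hk : k ≠ 0 := fun h => hs (by simp [h])
    obtain ⟨χ, hχ, hχc, hχ0, hχ1⟩ := exists_cutoff n
    obtain ⟨W, hW1, -, hW3⟩ := hcont χ hχ hχc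
    refine scalar_continuation_zero_ne_zero (continuousOn_coeffSq hi) (coeffSq_nonneg hi)
      (coeffSq_le hi) (fun t ht y => coeffSq_smul hi ht.ne' y) (stdVec_ne_zero 0)
      (coeffSq_stdVec_ne_zero hi 0) hχ.continuous hχc hχ0 hχ1 (hW1 0) (fun s hs => hW3 s hs 0) ?_
    have h := hzero hk hχ hχc (hW1 0) (fun s hs => hW3 s hs 0) ?_
    · simpa using h
    · rw [Ne, ascPochhammer_eval_eq_zero_iff]
      rintro ⟨j, hj, hj'⟩
      have : (j : ℂ) = k := by rw [hj']; ring
      exact hj.ne (by exact_mod_cast this)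
  · push Not at hpole
    obtain ⟨m, hm⟩ := exists_nat_gt (-s.re)
    have hre : 0 < (s + 2 * ((m + 1 : ℕ) : ℂ)).re := by
      have h0 : (0 : ℝ) ≤ m := m.cast_nonneg
      simp
      linarith
    obtain ⟨χ, hχ, hχc, hne⟩ := exists_rieszConv_scalarSymbol_ne_zero (continuousOn_coeffSq hi)
      (isAngular_coeffSq hi) (stdVec_ne_zero 0) (coeffSq_stdVec_ne_zero hi 0) hre
    obtain ⟨W, hW1, -, hW3⟩ := hcont χ hχ hχc
    have h := hzero m.succ_ne_zero hχ hχc (hW1 0) (fun s hs => hW3 s hs 0) ?_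
    · rw [hW3 _ hre] at h
      refine (mul_ne_zero (inv_ne_zero (Complex.Gamma_ne_zero_of_re_pos ?_)) hne) h
      rw [Complex.div_ofNat_re]
      linarith
    · rw [Ne, ascPochhammer_eval_eq_zero_iff]
      rintro ⟨j, hj, hj'⟩
      refine hpole j ?_
      rw [hj']
      ring

end KnappStein

end

theorem corollary4p7 (n i : ℕ) (hn : 1 ≤ n) (hi : i ≤ n) :
    (∃! T : ℂ → KnappStein.CompactForms n i →ₗ[ℂ] KnappStein.SmoothForms n i,
      KnappStein.IsKnappSteinFamily n i T) ∧
    ∀ T : ℂ → KnappStein.CompactForms n i →ₗ[ℂ] KnappStein.SmoothForms n i,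
      KnappStein.IsKnappSteinFamily n i T →
      ∀ lam : ℂ, T lam = 0 ↔ (Even n ∧ (i : ℂ) = (n : ℂ) / 2 ∧ lam = (n : ℂ) / 2) := by
  have : NeZero n := ⟨by omega⟩
  refine ⟨KnappStein.existsUnique_isKnappSteinFamily, fun T hT lam => ?_⟩
  have hmean : KnappStein.meanSymbol n i = 0 ↔ n = 2 * i := by
    have hn0 : (n : ℝ) ≠ 0 := Nat.cast_ne_zero.2 (NeZero.ne n)
    rw [KnappStein.meanSymbol, sub_eq_zero, eq_div_iff hn0, one_mul]
    norm_cast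
  have hi2 : (i : ℂ) = (n : ℂ) / 2 ↔ n = 2 * i := by
    rw [eq_div_iff two_ne_zero, mul_comm, eq_comm]
    norm_cast
  rw [hi2]
  constructor
  · intro h
    have hlam : lam = (n : ℂ) / 2 := by
      by_contra hne
      refine hT.ne_zero hi (s := 2 * lam - n) (fun h0 => hne ?_) ?_
      · linear_combination h0 / 2
      · rw [show (2 * lam - n + n : ℂ) / 2 = lam by ring, h]
    subst hlam
    have hni := hmean.1 ((hT.half_eq_zero_iff hi).1 h)
    exact ⟨⟨i, by omega⟩, hni, rfl⟩
  · rintro ⟨-, hni, rfl⟩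
    exact (hT.half_eq_zero_iff hi).2 (hmean.2 hni)
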